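/- Fix integers $k,N\ge 0$ and a $(k,N)$-memoryless network: $N$ nodes, among them $k$ source nodes $s_1,\dots,s_k$ and $k$ destination nodes $d_1,\dots,d_k$ (all $2k$ distinct; the other nodes are relays), and a channel given by an arbitrary conditional law (Markov kernel) of the real outputs $(Y_1,\dots,Y_N)$ given the real inputs $(U_1,\dots,U_N)$, used independently in every time slot. A memoryless source is an i.i.d. sequence of random vectors $(X_1[t],\dots,X_k[t])$ in $\mathbb{R}^k$. A coding scheme of block length $n\ge 1$ consists of measurable maps as follows: at time $t\in\{0,\dots,n-1\}$, source node $s_m$ sends a function of its whole source block $X_m[0],\dots,X_m[n-1]$ and of its own past channel outputs $Y_{s_m}[0],\dots,Y_{s_m}[t-1]$; every relay and every destination node sends a function of its own past channel outputs; and after the block each destination $d_m$ forms an estimate $(\hat X_m[0],\dots,\hat X_m[n-1])$ as a function of $Y_{d_m}[0],\dots,Y_{d_m}[n-1]$. A tuple $(D_1,\dots,D_k)\in\mathbb{R}^k$ is achievable (under quadratic distortion) for a given source if for some $n\ge1$ some coding scheme of block length $n$ satisfies $$\frac1n\,\mathbb{E}\Big[\sum_{t=0}^{n-1}(X_m[t]-\hat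 X_m[t])^2\Big]\le D_m\qquad\text{for all } m=1,\dots,k,$$ and the achievable distortion region of the source is the closure in $\mathbb{R}^k$ of the set of achievable tuples. Theorem. Let $K$ be a real $k\times k$ matrix, let $G$ be a memoryless source whose vectors are jointly Gaussian with covariance matrix $K$, and let $X$ be any memoryless source whose vectors have finite second moments and covariance matrix $K$ (no assumption is made on the means, and $K$ may be singular). Then the achievable distortion region for $G$ is contained in the achievable distortion region for $X$. Equivalently, if $(D_1,\dots,D_k)$ is achievable for $G$, then for every $\varepsilon>0$ the tuple $(D_1+\varepsilon,\dots,D_k+\varepsilon)$ is achievable for $X$. -/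

import Mathlib

open MeasureTheory ProbabilityTheory
open scoped NNReal

/-- A `(k, N)`-memoryless network: `N` nodes, `k` of them sources and `k` of them destinations
(all `2 k` distinct), and a stochastic channel which maps the vector of the `N` real inputs of a
time slot to the law of the vector of the `N` real outputs of that time slot. The conditional law
is an arbitrary Markov kernel, so it may have a density, be deterministic, or be neither. -/
structure MemorylessNetwork (k N : ℕ) where
  /-- the source node `s_m` -/
  src : Fin k → Fin N
  /-- the destination node `d_m` -/
  dst : Fin k → Fin N
  src_injective : Function.Injective src
  dst_injective : Function.Injective dst
  src_ne_dst : ∀ m m', src m ≠ dst m'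
  /-- the conditional law of `(Y_1, …, Y_N)` given `(U_1, …, U_N)` -/
  channel : Kernel (Fin N → ℝ) (Fin N → ℝ)
  channel_markov : IsMarkovKernel channel

namespace MemorylessNetwork

variable {k N : ℕ}

/-- The relay nodes: the nodes that are neither sources nor destinations. -/
def Relay (net : MemorylessNetwork k N) : Type :=
  {i : Fin N // (¬ ∃ m, net.src m = i) ∧ ¬ ∃ m, net.dst m = i}

/-- A coding scheme with block length `n`. Time is `0, …, n - 1`; at time `t` a node may use
its own channel outputs of the times `0, …, t - 1`, and a source node moreover the whole block
of its own source. All maps are measurable. -/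
structure CodingScheme (net : MemorylessNetwork k N) (n : ℕ) where
  /-- source encoding functions `f_{s_m,t}` -/
  srcEnc : (m : Fin k) → (t : Fin n) → (Fin n → ℝ) × (Fin t → ℝ) → ℝ
  /-- relay encoding functions `f_{r_p,t}` -/
  relayEnc : (r : net.Relay) → (t : Fin n) → (Fin t → ℝ) → ℝ
  /-- destination encoding functions `f_{d_m,t}` -/
  dstEnc : (m : Fin k) → (t : Fin n) → (Fin t → ℝ) → ℝ
  /-- destination decoding functions `g_{d_m}` -/
  dec : (m : Fin k) → (Fin n → ℝ) → (Fin n → ℝ)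
  measurable_srcEnc : ∀ m t, Measurable (srcEnc m t)
  measurable_relayEnc : ∀ r t, Measurable (relayEnc r t)
  measurable_dstEnc : ∀ m t, Measurable (dstEnc m t)
  measurable_dec : ∀ m, Measurable (dec m)

namespace CodingScheme

variable {net : MemorylessNetwork k N} {n : ℕ}

/-- The channel inputs `(U_1[t], …, U_N[t])` at time `t`, as a function of the source block `x`
(`x τ m` is the symbol `X_m[τ]`) and of all channel outputs `y` of the times before `t`
(`y τ i` is `Y_i[τ]`). Each node reads only its own part of these. -/
noncomputable def input (C : net.CodingScheme n) (t : Fin n)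
    (p : (Fin n → Fin k → ℝ) × (Fin t → Fin N → ℝ)) : Fin N → ℝ := fun i =>
  if hs : ∃ m, net.src m = i then
    C.srcEnc hs.choose t (fun τ => p.1 τ hs.choose, fun τ => p.2 τ i)
  else if hd : ∃ m, net.dst m = i then
    C.dstEnc hd.choose t (fun τ => p.2 τ i)
  else C.relayEnc ⟨i, hs, hd⟩ t (fun τ => p.2 τ i)

theorem measurable_input (C : net.CodingScheme n) (t : Fin n) : Measurable (C.input t) := by
  refine measurable_pi_lambda _ fun i => ?_
  unfold input
  split_ifs with hs hd
  · exact (C.measurable_srcEnc _ _).comp (by fun_prop)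
  · exact (C.measurable_dstEnc _ _).comp (by fun_prop)
  · exact (C.measurable_relayEnc _ _).comp (by fun_prop)

theorem measurable_snoc (t : ℕ) :
    Measurable fun p : (Fin t → Fin N → ℝ) × (Fin N → ℝ) =>
      (Fin.snoc (α := fun _ => Fin N → ℝ) p.1 p.2 : Fin (t + 1) → Fin N → ℝ) := by
  refine measurable_pi_lambda _ fun j => ?_
  refine Fin.lastCases ?_ (fun j => ?_) j
  · simpa using measurable_snd
  · simp only [Fin.snoc_castSucc]
    fun_prop

/-- The conditional law, given the source block, of the channel outputs of the first `t` time
slots. The outputs of slot `t` are drawn from the channel law at the inputs of slot `t`, and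
depend on the source block and on the earlier outputs only through these inputs. -/
noncomputable def outputKernel (C : net.CodingScheme n) :
    (t : ℕ) → t ≤ n → Kernel (Fin n → Fin k → ℝ) (Fin t → Fin N → ℝ)
  | 0, _ => Kernel.const _ (Measure.dirac Fin.elim0)
  | t + 1, h =>
    (C.outputKernel t (Nat.le_of_succ_le h) ⊗ₖ
      net.channel.comap (C.input ⟨t, h⟩) (C.measurable_input ⟨t, h⟩)).map
        fun p => (Fin.snoc (α := fun _ => Fin N → ℝ) p.1 p.2 : Fin (t + 1) → Fin N → ℝ)

instance isMarkovKernel_outputKernel (C : net.CodingScheme n) (t : ℕ) (h : t ≤ n) :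
    IsMarkovKernel (C.outputKernel t h) := by
  induction t with
  | zero => unfold outputKernel; infer_instance
  | succ t ih =>
    have := ih (Nat.le_of_succ_le h)
    have := net.channel_markov
    unfold outputKernel
    exact Kernel.IsMarkovKernel.map _ (measurable_snoc t)

/-- The joint law of the source block and of all channel outputs, when the coding scheme is used
with the memoryless source of single-letter law `P`, that is, when the vectors
`(X_1[t], …, X_k[t])` are i.i.d. with law `P`. -/
noncomputable def jointLaw (C : net.CodingScheme n) (P : Measure (Fin k → ℝ))
    [IsProbabilityMeasure P] : Measure ((Fin n → Fin k → ℝ) × (Fin n → Fin N → ℝ)) :=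
  (Measure.pi fun _ : Fin n => P) ⊗ₘ C.outputKernel n le_rfl

/-- The total distortion `∑ t, φ (X_m[t], X̂_m[t])` of the `m`-th source over the block. -/
noncomputable def distortion (C : net.CodingScheme n) (φ : ℝ → ℝ → ℝ≥0) (m : Fin k)
    (p : (Fin n → Fin k → ℝ) × (Fin n → Fin N → ℝ)) : ℝ :=
  ∑ t, (φ (p.1 t m) (C.dec m (fun τ => p.2 τ (net.dst m)) t) : ℝ)

end CodingScheme

/-- The distortion tuple `D` is `φ`-achievable over the network for the memoryless source of
single-letter law `P`: for some block length `n ≥ 1` some coding scheme has, for every `m`, a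
finite expected distortion per symbol which is at most `D m`. -/
def Achievable (net : MemorylessNetwork k N) (φ : ℝ → ℝ → ℝ≥0) (P : Measure (Fin k → ℝ))
    [IsProbabilityMeasure P] (D : Fin k → ℝ) : Prop :=
  ∃ n : ℕ, 0 < n ∧ ∃ C : net.CodingScheme n, ∀ m,
    Integrable (C.distortion φ m) (C.jointLaw P) ∧
      (1 / n : ℝ) * ∫ p, C.distortion φ m p ∂(C.jointLaw P) ≤ D m

/-- The `φ`-achievable distortion region: the closure of the set of achievable tuples. -/
def distortionRegion (net : MemorylessNetwork k N) (φ : ℝ → ℝ → ℝ≥0)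
    (P : Measure (Fin k → ℝ)) [IsProbabilityMeasure P] : Set (Fin k → ℝ) :=
  closure {D | net.Achievable φ P D}

end MemorylessNetwork

/-- The quadratic distortion measure `(x, y) ↦ (x - y) ^ 2`. -/
def quadraticDistortion (x y : ℝ) : ℝ≥0 := ⟨(x - y) ^ 2, sq_nonneg _⟩

/-- The random vector with law `P` has finite second moments and covariance matrix `K`. -/
structure HasCovarianceMatrix {k : ℕ} (P : Measure (Fin k → ℝ)) (K : Matrix (Fin k) (Fin k) ℝ) :
    Prop where
  memLp : ∀ i, MemLp (fun x : Fin k → ℝ => x i) 2 P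
  covariance_eq : ∀ i j, cov[fun x : Fin k → ℝ => x i, fun x : Fin k → ℝ => x j; P] = K i j

/-! A scheme `C` that is good for the Gaussian source is reused for `X` by making the symbols that
`C` sees nearly Gaussian. Cut a long block of `X` into two halves, rotate them by 45 degrees, send
each rotated half by its own scheme, and rotate the estimates back (`CodingScheme.rotate`). A
rotation preserves squared error, so the distortions of the two halves add up. The rotated halves
may be dependent, but each one alone is an i.i.d. block, and linearity of expectation needs no more
(`Feasible.rotate`). After `r` repetitions the schemes see normalized signed sums of `2 ^ r`
independent copies of `X`; these keep the covariance `K` and tend to the Gaussian law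
(`tendsto_charFunDual_butterflyLeaf`).

Weak convergence alone does not control the distortion of a scheme that is merely measurable. Hence
a little Gaussian dither is mixed in, giving `a X + b Z`. Such a law is the image, under a fixed
linear factor of `K`, of a law with a density on some `ℝ ^ d`, and these densities converge
pointwise (`tendsto_smoothDensity`). Fatou's lemma for `W - H`, where `H` is the conditional
distortion and `W` a quadratic bound, then bounds the limiting distortion by the Gaussian one
(`IsCentered.eventually_lintegral_pi_mix_lt`). The bound `W` exists once the estimates are clipped,
which costs arbitrarily little for the Gaussian source, and its expectation depends on `K` only.

The dither is shared by encoders and decoders, so it can be subtracted at the destinations;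
rescaling by `a` costs a factor `1 / a ^ 2`, close to 1. Its randomness is removed by time sharing
over its realizations: the closed region is convex, so it contains the mean distortion tuple
(`add_mem_dyadicRegion_of_random`). -/

open Filter Topology

/-! ### Output laws of coding schemes and their restriction to time segments. -/

namespace MemorylessNetwork

namespace CodingScheme

variable {k N : ℕ} {net : MemorylessNetwork k N} {n n' : ℕ}

/-- `input` picks a node's source or destination index by `choose`. The chosen index maps back to
the node, so it suffices to compare encoders index by index. -/
theorem input_congr {C : net.CodingScheme n} {C' : net.CodingScheme n'} {t : Fin n} {t' : Fin n'}
    {p : (Fin n → Fin k → ℝ) × (Fin t → Fin N → ℝ)}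
    {p' : (Fin n' → Fin k → ℝ) × (Fin t' → Fin N → ℝ)}
    (hsrc : ∀ m, C.srcEnc m t (fun τ => p.1 τ m, fun τ => p.2 τ (net.src m)) =
      C'.srcEnc m t' (fun τ => p'.1 τ m, fun τ => p'.2 τ (net.src m)))
    (hdst : ∀ m, C.dstEnc m t (fun τ => p.2 τ (net.dst m)) =
      C'.dstEnc m t' (fun τ => p'.2 τ (net.dst m)))
    (hrel : ∀ r : net.Relay, C.relayEnc r t (fun τ => p.2 τ r.1) =
      C'.relayEnc r t' (fun τ => p'.2 τ r.1)) :
    C.input t p = C'.input t' p' := by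
  ext i
  unfold input
  split_ifs with hs hd
  · have := hsrc hs.choose
    simpa only [hs.choose_spec] using this
  · have := hdst hd.choose
    simpa only [hd.choose_spec] using this
  · exact hrel ⟨i, hs, hd⟩

theorem lintegral_outputKernel_succ (C : net.CodingScheme n) (t : ℕ) (h : t + 1 ≤ n)
    (x : Fin n → Fin k → ℝ) {f : (Fin (t + 1) → Fin N → ℝ) → ENNReal} (hf : Measurable f) :
    ∫⁻ z, f z ∂C.outputKernel (t + 1) h x =
      ∫⁻ y, ∫⁻ u, f (Fin.snoc (α := fun _ => Fin N → ℝ) y u)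
        ∂net.channel (C.input ⟨t, h⟩ (x, y)) ∂C.outputKernel t (Nat.le_of_succ_le h) x := by
  have := net.channel_markov
  rw [outputKernel, Kernel.lintegral_map _ (measurable_snoc t) _ hf,
    Kernel.lintegral_compProd _ _ _ (f := fun p => f (Fin.snoc (α := fun _ => Fin N → ℝ) p.1 p.2))
      (hf.comp (measurable_snoc t))]
  rfl

theorem outputKernel_congr {C : net.CodingScheme n} {C' : net.CodingScheme n'}
    {x : Fin n → Fin k → ℝ} {x' : Fin n' → Fin k → ℝ} (t : ℕ) (ht : t ≤ n) (ht' : t ≤ n')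
    (h : ∀ (s : ℕ) (hs : s < t) (y : Fin s → Fin N → ℝ),
      C.input ⟨s, hs.trans_le ht⟩ (x, y) = C'.input ⟨s, hs.trans_le ht'⟩ (x', y)) :
    C.outputKernel t ht x = C'.outputKernel t ht' x' := by
  induction t with
  | zero => rfl
  | succ t ih =>
    refine Measure.ext_of_lintegral _ fun f hf => ?_
    rw [lintegral_outputKernel_succ _ _ _ _ hf, lintegral_outputKernel_succ _ _ _ _ hf,
      ih (by omega) (by omega) fun s hs y => h s (hs.trans (Nat.lt_succ_self t)) y]
    simp_rw [h t (Nat.lt_succ_self t)]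

/-- The later slots integrate out one at a time, because the channel kernel has total mass one. -/
theorem map_outputKernel_castAdd (C : net.CodingScheme n) (x : Fin n → Fin k → ℝ) (a b : ℕ)
    (h : a + b ≤ n) :
    (C.outputKernel (a + b) h x).map (fun y (τ : Fin a) => y (Fin.castAdd b τ)) =
      C.outputKernel a (by omega) x := by
  induction b with
  | zero => exact Measure.map_id
  | succ b ih =>
    have := net.channel_markov
    rw [← ih (by omega)]
    refine Measure.ext_of_lintegral _ fun f hf => ?_
    rw [lintegral_map hf (by fun_prop), lintegral_map hf (by fun_prop)]
    erw [lintegral_outputKernel_succ C (a + b) h x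
      (f := fun y => f fun τ : Fin a => y (Fin.castAdd (b + 1) τ)) (by fun_prop)]
    refine lintegral_congr fun y => ?_
    simp

/-- The channel is memoryless: if from time `a` on the inputs ignore the first `a` outputs, the
process restarts at time `a` whatever happened before. Those first outputs are integrated out in the
base case. -/
theorem map_outputKernel_natAdd {C : net.CodingScheme n} {C' : net.CodingScheme n'}
    {x : Fin n → Fin k → ℝ} {x' : Fin n' → Fin k → ℝ} (a t : ℕ) (ht : a + t ≤ n) (ht' : t ≤ n')
    (h : ∀ (s : ℕ) (hs : s < t) (y : Fin (a + s) → Fin N → ℝ),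
      C.input ⟨a + s, by omega⟩ (x, y) =
        C'.input ⟨s, hs.trans_le ht'⟩ (x', fun τ => y (Fin.natAdd a τ))) :
    (C.outputKernel (a + t) ht x).map (fun y (τ : Fin t) => y (Fin.natAdd a τ)) =
      C'.outputKernel t ht' x' := by
  induction t with
  | zero =>
    refine Measure.ext_of_lintegral _ fun f hf => ?_
    rw [lintegral_map hf (by fun_prop)]
    have : ∀ y : Fin (a + 0) → Fin N → ℝ,
        (fun τ : Fin 0 => y (Fin.natAdd a τ)) = Fin.elim0 := fun y => Subsingleton.elim _ _
    simp [this, outputKernel]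
  | succ t ih =>
    refine Measure.ext_of_lintegral _ fun f hf => ?_
    rw [lintegral_map hf (by fun_prop), lintegral_outputKernel_succ _ _ _ _ hf,
      ← ih (by omega) (by omega) fun s hs y => h s (hs.trans (Nat.lt_succ_self t)) y]
    erw [lintegral_outputKernel_succ C (a + t) ht x
      (f := fun y => f fun τ : Fin (t + 1) => y (Fin.natAdd a τ)) (by fun_prop)]
    have := net.channel_markov
    rw [lintegral_map ?_ (by fun_prop)]
    · refine lintegral_congr fun y => ?_
      have e := h t (Nat.lt_succ_self t) y
      rw [← e]
      refine lintegral_congr fun u => congrArg f ?_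
      ext τ : 1
      refine Fin.lastCases ?_ (fun τ => ?_) τ
      · rw [Fin.snoc_last]
        exact Fin.snoc_last (α := fun _ => Fin N → ℝ) u y
      · rw [Fin.snoc_castSucc]
        exact Fin.snoc_castSucc (α := fun _ => Fin N → ℝ) u y (Fin.natAdd a τ)
    · exact Measurable.lintegral_kernel_prod_right' (κ := net.channel.comap
        (fun y => C'.input ⟨t, ht'⟩ (x', y))
        ((C'.measurable_input ⟨t, ht'⟩).comp measurable_prodMk_left))
        (hf.comp (measurable_snoc t))

end CodingScheme

end MemorylessNetwork

/-! ### Rotating i.i.d. blocks. -/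

/-- The law of `c X + s Z` for independent `X` and `Z` of laws `Q` and `R`. -/
noncomputable def mix {k : ℕ} (c s : ℝ) (Q R : Measure (Fin k → ℝ)) : Measure (Fin k → ℝ) :=
  (Q.prod R).map fun p => c • p.1 + s • p.2

instance isProbabilityMeasure_mix {k : ℕ} (c s : ℝ) (Q R : Measure (Fin k → ℝ))
    [IsProbabilityMeasure Q] [IsProbabilityMeasure R] : IsProbabilityMeasure (mix c s Q R) :=
  Measure.isProbabilityMeasure_map (by fun_prop)

theorem measurePreserving_pi_mix {k : ℕ} (n : ℕ) (c s : ℝ) (Q R : Measure (Fin k → ℝ))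
    [IsProbabilityMeasure Q] [IsProbabilityMeasure R] :
    MeasurePreserving
      (fun p : (Fin n → Fin k → ℝ) × (Fin n → Fin k → ℝ) => c • p.1 + s • p.2)
      ((Measure.pi fun _ => Q).prod (Measure.pi fun _ => R)) (Measure.pi fun _ => mix c s Q R) := by
  have h1 := (measurePreserving_arrowProdEquivProdArrow (Fin k → ℝ) (Fin k → ℝ) (Fin n)
    (fun _ => Q) (fun _ => R)).symm
  have h2 : MeasurePreserving (fun p : (Fin k → ℝ) × (Fin k → ℝ) => c • p.1 + s • p.2)
      (Q.prod R) (mix c s Q R) := ⟨by fun_prop, rfl⟩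
  exact (measurePreserving_pi (ι := Fin n) (fun _ => Q.prod R) (fun _ => mix c s Q R)
    fun _ => h2).comp h1

/-- The linear combination of the two halves of a block of length `n + n`. -/
def combineHalves {k n : ℕ} (c s : ℝ) (x : Fin (n + n) → Fin k → ℝ) : Fin n → Fin k → ℝ :=
  fun τ => c • x (Fin.castAdd n τ) + s • x (Fin.natAdd n τ)

/-- The halves of an i.i.d. block are independent and are combined slot by slot. Only the law of one
combination is needed; the joint law of both rotated halves never enters. -/
theorem measurePreserving_combineHalves {k : ℕ} (n : ℕ) (c s : ℝ) (P : Measure (Fin k → ℝ))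
    [IsProbabilityMeasure P] :
    MeasurePreserving (combineHalves (n := n) c s) (Measure.pi fun _ => P)
      (Measure.pi fun _ => mix c s P P) := by
  have h1 := (measurePreserving_piCongrLeft (fun _ : Fin (n + n) => P)
    (finSumFinEquiv (m := n) (n := n))).symm
  have h2 := measurePreserving_sumPiEquivProdPi (fun _ : Fin n ⊕ Fin n => P)
  exact (measurePreserving_pi_mix n c s P P).comp (h2.comp h1)

/-! ### Modified schemes: affine precoding, clipping, rotation. -/

namespace MemorylessNetwork

namespace CodingScheme

variable {k N : ℕ} {net : MemorylessNetwork k N} {n : ℕ}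

/-- The conditional expectation of the quadratic distortion, given the source block. -/
noncomputable def condDistortion (C : net.CodingScheme n) (m : Fin k) (x : Fin n → Fin k → ℝ) :
    ENNReal :=
  ∫⁻ y, ENNReal.ofReal (C.distortion quadraticDistortion m (x, y)) ∂C.outputKernel n le_rfl x

theorem distortion_quadratic (C : net.CodingScheme n) (m : Fin k)
    (p : (Fin n → Fin k → ℝ) × (Fin n → Fin N → ℝ)) :
    C.distortion quadraticDistortion m p =
      ∑ t, (p.1 t m - C.dec m (fun τ => p.2 τ (net.dst m)) t) ^ 2 := rfl

theorem distortion_nonneg (C : net.CodingScheme n) (m : Fin k)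
    (p : (Fin n → Fin k → ℝ) × (Fin n → Fin N → ℝ)) :
    0 ≤ C.distortion quadraticDistortion m p := by
  rw [distortion_quadratic]
  positivity

@[fun_prop]
theorem measurable_distortion (C : net.CodingScheme n) (m : Fin k) :
    Measurable (C.distortion quadraticDistortion m) := by
  have h := C.measurable_dec m
  have h' : Measurable fun p : (Fin n → Fin k → ℝ) × (Fin n → Fin N → ℝ) =>
      C.dec m (fun τ => p.2 τ (net.dst m)) := h.comp (by fun_prop)
  have : C.distortion quadraticDistortion m = fun p =>
      ∑ t, (p.1 t m - C.dec m (fun τ => p.2 τ (net.dst m)) t) ^ 2 :=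
    funext fun p => C.distortion_quadratic m p
  rw [this]
  refine Finset.measurable_sum _ fun t _ => Measurable.pow_const (Measurable.sub (by fun_prop) ?_) 2
  exact (measurable_pi_apply t).comp h'

@[fun_prop]
theorem measurable_condDistortion (C : net.CodingScheme n) (m : Fin k) :
    Measurable (C.condDistortion m) :=
  Measurable.lintegral_kernel_prod_right' (κ := C.outputKernel n le_rfl)
    (f := fun p => ENNReal.ofReal (C.distortion quadraticDistortion m p)) (by fun_prop)

theorem lintegral_condDistortion (C : net.CodingScheme n) (m : Fin k) (P : Measure (Fin k → ℝ))
    [IsProbabilityMeasure P] :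
    ∫⁻ x, C.condDistortion m x ∂(Measure.pi fun _ => P) =
      ∫⁻ p, ENNReal.ofReal (C.distortion quadraticDistortion m p) ∂C.jointLaw P := by
  rw [jointLaw, Measure.lintegral_compProd (by fun_prop)]
  rfl

/-- The scheme which precodes the source symbols with `x ↦ a x + b` and undoes this at the
destinations. -/
noncomputable def affine (C : net.CodingScheme n) (a : ℝ) (b : Fin n → Fin k → ℝ) :
    net.CodingScheme n where
  srcEnc m t p := C.srcEnc m t (fun τ => a * p.1 τ + b τ m, p.2)
  relayEnc := C.relayEnc
  dstEnc := C.dstEnc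
  dec m y t := (C.dec m y t - b t m) / a
  measurable_srcEnc m t := (C.measurable_srcEnc m t).comp (by fun_prop)
  measurable_relayEnc := C.measurable_relayEnc
  measurable_dstEnc := C.measurable_dstEnc
  measurable_dec m := by
    have h := C.measurable_dec m
    refine measurable_pi_lambda _ fun t => ?_
    have := (measurable_pi_apply t).comp h
    exact (this.sub_const _).div_const _

theorem condDistortion_affine (C : net.CodingScheme n) {a : ℝ} (ha : a ≠ 0)
    (b : Fin n → Fin k → ℝ) (m : Fin k) (x : Fin n → Fin k → ℝ) :
    (C.affine a b).condDistortion m x =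
      ENNReal.ofReal ((a ^ 2)⁻¹) * C.condDistortion m (a • x + b) := by
  have h : (C.affine a b).outputKernel n le_rfl x = C.outputKernel n le_rfl (a • x + b) :=
    outputKernel_congr n le_rfl le_rfl
      fun s hs y => input_congr (fun _ => rfl) (fun _ => rfl) fun _ => rfl
  unfold condDistortion
  rw [h, ← lintegral_const_mul _ (by fun_prop)]
  refine lintegral_congr fun y => ?_
  rw [← ENNReal.ofReal_mul (by positivity), distortion_quadratic, distortion_quadratic,
    Finset.mul_sum]
  congr 1
  refine Finset.sum_congr rfl fun t _ => ?_
  simp only [affine, Pi.add_apply, Pi.smul_apply, smul_eq_mul]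
  field_simp
  ring

/-- The scheme whose estimates are truncated to `[-B, B]`. -/
noncomputable def clip (C : net.CodingScheme n) (B : ℝ) : net.CodingScheme n where
  __ := C
  dec m y t := max (-B) (min B (C.dec m y t))
  measurable_dec m := by
    have h := C.measurable_dec m
    refine measurable_pi_lambda _ fun t => ?_
    have := (measurable_pi_apply t).comp h
    exact measurable_const.max (measurable_const.min this)

theorem outputKernel_clip (C : net.CodingScheme n) (B : ℝ) (t : ℕ) (ht : t ≤ n)
    (x : Fin n → Fin k → ℝ) : (C.clip B).outputKernel t ht x = C.outputKernel t ht x :=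
  outputKernel_congr t ht ht fun _ _ _ =>
    input_congr (fun _ => rfl) (fun _ => rfl) fun _ => rfl

/-- The scheme of length `n + n` which rotates the two halves of the source block, sends the first
rotated half with `C₁` and the second one with `C₂`, and undoes the rotation at the
destinations. -/
noncomputable def rotate (C₁ C₂ : net.CodingScheme n) (c s : ℝ) : net.CodingScheme (n + n) where
  srcEnc m t p :=
    if h : (t : ℕ) < n then
      C₁.srcEnc m ⟨t, h⟩
        (fun τ => c * p.1 (Fin.castAdd n τ) + s * p.1 (Fin.natAdd n τ), p.2)
    else
      C₂.srcEnc m ⟨t - n, by omega⟩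
        (fun τ => -s * p.1 (Fin.castAdd n τ) + c * p.1 (Fin.natAdd n τ),
          fun τ : Fin (t - n) => p.2 ⟨n + τ, by omega⟩)
  relayEnc r t y :=
    if h : (t : ℕ) < n then C₁.relayEnc r ⟨t, h⟩ y
    else C₂.relayEnc r ⟨t - n, by omega⟩ fun τ : Fin (t - n) => y ⟨n + τ, by omega⟩
  dstEnc m t y :=
    if h : (t : ℕ) < n then C₁.dstEnc m ⟨t, h⟩ y
    else C₂.dstEnc m ⟨t - n, by omega⟩ fun τ : Fin (t - n) => y ⟨n + τ, by omega⟩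
  dec m y := Fin.append
    (fun τ => c * C₁.dec m (fun σ => y (Fin.castAdd n σ)) τ -
      s * C₂.dec m (fun σ => y (Fin.natAdd n σ)) τ)
    (fun τ => s * C₁.dec m (fun σ => y (Fin.castAdd n σ)) τ +
      c * C₂.dec m (fun σ => y (Fin.natAdd n σ)) τ)
  measurable_srcEnc m t := by
    split_ifs with h
    · exact (C₁.measurable_srcEnc m ⟨t, h⟩).comp (by fun_prop)
    · exact (C₂.measurable_srcEnc m ⟨t - n, by omega⟩).comp (by fun_prop)
  measurable_relayEnc r t := by
    split_ifs with h
    · exact C₁.measurable_relayEnc r ⟨t, h⟩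
    · exact (C₂.measurable_relayEnc r ⟨t - n, by omega⟩).comp (by fun_prop)
  measurable_dstEnc m t := by
    split_ifs with h
    · exact C₁.measurable_dstEnc m ⟨t, h⟩
    · exact (C₂.measurable_dstEnc m ⟨t - n, by omega⟩).comp (by fun_prop)
  measurable_dec m := by
    have h₁ : Measurable fun y : Fin (n + n) → ℝ => C₁.dec m (fun σ => y (Fin.castAdd n σ)) :=
      (C₁.measurable_dec m).comp (by fun_prop)
    have h₂ : Measurable fun y : Fin (n + n) → ℝ => C₂.dec m (fun σ => y (Fin.natAdd n σ)) :=
      (C₂.measurable_dec m).comp (by fun_prop)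
    refine measurable_pi_lambda _ fun t => ?_
    have h₁' := fun τ => (measurable_pi_apply τ).comp h₁
    have h₂' := fun τ => (measurable_pi_apply τ).comp h₂
    refine Fin.addCases (fun τ => ?_) (fun τ => ?_) t
    · simp only [Fin.append_left]
      exact ((h₁' τ).const_mul c).sub ((h₂' τ).const_mul s)
    · simp only [Fin.append_right]
      exact ((h₁' τ).const_mul s).add ((h₂' τ).const_mul c)

theorem rotate_input_castAdd (C₁ C₂ : net.CodingScheme n) (c s : ℝ) (x : Fin (n + n) → Fin k → ℝ)
    {t : ℕ} (ht : t < n) (y : Fin t → Fin N → ℝ) :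
    (rotate C₁ C₂ c s).input ⟨t, by omega⟩ (x, y) =
      C₁.input ⟨t, ht⟩ (combineHalves c s x, y) := by
  refine input_congr (fun m => ?_) (fun m => ?_) fun r => ?_ <;> exact dif_pos ht

theorem rotate_input_natAdd (C₁ C₂ : net.CodingScheme n) (c s : ℝ) (x : Fin (n + n) → Fin k → ℝ)
    {t : ℕ} (ht : t < n) (y : Fin (n + t) → Fin N → ℝ) :
    (rotate C₁ C₂ c s).input ⟨n + t, by omega⟩ (x, y) =
      C₂.input ⟨t, ht⟩ (combineHalves (-s) c x, fun τ => y (Fin.natAdd n τ)) := by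
  -- The index `n + t - n` occurs in types and equals `t` only propositionally, so it is generalized
  -- to `u` before substitution.
  have key : ∀ (u : ℕ) (hu : u = t) (huv : ∀ τ : Fin u, n + (τ : ℕ) < n + t)
      (m : Fin k), C₂.srcEnc m ⟨u, hu ▸ ht⟩ (fun τ => combineHalves (-s) c x τ m,
        fun τ : Fin u => y ⟨n + τ, huv τ⟩ (net.src m)) =
      C₂.srcEnc m ⟨t, ht⟩ (fun τ => combineHalves (-s) c x τ m,
        fun τ => y (Fin.natAdd n τ) (net.src m)) := by
    intro u hu; subst hu; intros; rfl
  have key' : ∀ (u : ℕ) (hu : u = t) (huv : ∀ τ : Fin u, n + (τ : ℕ) < n + t)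
      (m : Fin k), C₂.dstEnc m ⟨u, hu ▸ ht⟩ (fun τ : Fin u => y ⟨n + τ, huv τ⟩ (net.dst m)) =
      C₂.dstEnc m ⟨t, ht⟩ (fun τ => y (Fin.natAdd n τ) (net.dst m)) := by
    intro u hu; subst hu; intros; rfl
  have key'' : ∀ (u : ℕ) (hu : u = t) (huv : ∀ τ : Fin u, n + (τ : ℕ) < n + t)
      (r : net.Relay), C₂.relayEnc r ⟨u, hu ▸ ht⟩ (fun τ : Fin u => y ⟨n + τ, huv τ⟩ r.1) =
      C₂.relayEnc r ⟨t, ht⟩ (fun τ => y (Fin.natAdd n τ) r.1) := by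
    intro u hu; subst hu; intros; rfl
  have hn : ¬ n + t < n := by omega
  refine input_congr (fun m => ?_) (fun m => ?_) fun r => ?_
  · exact (dif_neg hn).trans (key (n + t - n) (by omega) (by omega) m)
  · exact (dif_neg hn).trans (key' (n + t - n) (by omega) (by omega) m)
  · exact (dif_neg hn).trans (key'' (n + t - n) (by omega) (by omega) r)

/-- Rotating the error vector of a pair of slots leaves its length unchanged, and the outputs of the
two time segments have the laws produced by `C₁` and `C₂` on the rotated blocks. -/
theorem condDistortion_rotate (C₁ C₂ : net.CodingScheme n) {c s : ℝ} (hcs : c ^ 2 + s ^ 2 = 1)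
    (m : Fin k) (x : Fin (n + n) → Fin k → ℝ) :
    (rotate C₁ C₂ c s).condDistortion m x =
      C₁.condDistortion m (combineHalves c s x) +
        C₂.condDistortion m (combineHalves (-s) c x) := by
  have h₁ : C₁.outputKernel n le_rfl (combineHalves c s x) =
      ((rotate C₁ C₂ c s).outputKernel (n + n) le_rfl x).map
        (fun y (τ : Fin n) => y (Fin.castAdd n τ)) := by
    rw [map_outputKernel_castAdd]
    exact (outputKernel_congr n (by omega) le_rfl fun t ht y =>
      rotate_input_castAdd C₁ C₂ c s x ht y).symm
  have h₂ : C₂.outputKernel n le_rfl (combineHalves (-s) c x) =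
      ((rotate C₁ C₂ c s).outputKernel (n + n) le_rfl x).map
        (fun y (τ : Fin n) => y (Fin.natAdd n τ)) :=
    (map_outputKernel_natAdd n n le_rfl le_rfl fun t ht y =>
      rotate_input_natAdd C₁ C₂ c s x ht y).symm
  unfold condDistortion
  rw [h₁, h₂, lintegral_map (by fun_prop) (by fun_prop), lintegral_map (by fun_prop) (by fun_prop),
    ← lintegral_add_left (by fun_prop)]
  refine lintegral_congr fun y => ?_
  rw [← ENNReal.ofReal_add (distortion_nonneg _ _ _) (distortion_nonneg _ _ _)]
  congr 1
  simp only [distortion_quadratic, Fin.sum_univ_add, rotate, Fin.append_left, Fin.append_right]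
  rw [← Finset.sum_add_distrib, ← Finset.sum_add_distrib]
  refine Finset.sum_congr rfl fun τ _ => ?_
  simp only [combineHalves, Pi.add_apply, Pi.smul_apply, smul_eq_mul]
  generalize C₁.dec m _ τ = d₁
  generalize C₂.dec m _ τ = d₂
  generalize x (Fin.castAdd n τ) m = x₁
  generalize x (Fin.natAdd n τ) m = x₂
  linear_combination (-(x₁ ^ 2) - x₂ ^ 2 + d₁ ^ 2 + d₂ ^ 2) * hcs

end CodingScheme

end MemorylessNetwork

/-! ### Closed midpoint-convex sets. -/

theorem convex_of_isClosed_of_midpoint_mem {E : Type*} [AddCommGroup E] [Module ℝ E]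
    [TopologicalSpace E] [ContinuousAdd E] [ContinuousSMul ℝ E] {S : Set E} (hS : IsClosed S)
    (hmid : ∀ x ∈ S, ∀ y ∈ S, (1 / 2 : ℝ) • (x + y) ∈ S) : Convex ℝ S := by
  intro x hx y hy a b ha hb hab
  by_contra hne
  let f : ℝ → E := fun t => (1 - t) • x + t • y
  have hf : Continuous f := by fun_prop
  let T : Set ℝ := f ⁻¹' S
  have hT : IsClosed T := hS.preimage hf
  have hTmid : ∀ s ∈ T, ∀ t ∈ T, (s + t) / 2 ∈ T := by
    intro s hs t ht
    have := hmid _ hs _ ht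
    have e : (1 / 2 : ℝ) • (f s + f t) = f ((s + t) / 2) := by
      simp only [f]
      module
    rwa [e] at this
  have h0 : (0 : ℝ) ∈ T := by simpa [T, f] using hx
  have h1 : (1 : ℝ) ∈ T := by simpa [T, f] using hy
  have hb' : b ∉ T := by
    have : a = 1 - b := by linarith
    simpa [T, f, ← this] using hne
  -- If `b` were missing, the nearest points of the closed set `T` on either side of `b` would bound
  -- a gap, and their midpoint, a point of `T`, would lie inside it.
  have hbdd : BddAbove (T ∩ Set.Iic b) := ⟨b, fun _ h => h.2⟩
  have hbdd' : BddBelow (T ∩ Set.Ici b) := ⟨b, fun _ h => h.2⟩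
  obtain ⟨hlT, hlb⟩ := (hT.inter isClosed_Iic).csSup_mem ⟨0, h0, hb⟩ hbdd
  obtain ⟨huT, hub⟩ := (hT.inter isClosed_Ici).csInf_mem
    ⟨1, h1, show b ≤ 1 by linarith⟩ hbdd'
  have hlb' : sSup (T ∩ Set.Iic b) < b := lt_of_le_of_ne hlb fun h => hb' (h ▸ hlT)
  have hub' : b < sInf (T ∩ Set.Ici b) := lt_of_le_of_ne hub fun h => hb' (h ▸ huT)
  have hq := hTmid _ hlT _ huT
  rcases le_total ((sSup (T ∩ Set.Iic b) + sInf (T ∩ Set.Ici b)) / 2) b with h | h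
  · linarith [le_csSup hbdd ⟨hq, h⟩]
  · linarith [csInf_le hbdd' ⟨hq, h⟩]

/-! ### Feasible tuples, time sharing and convexity. -/

namespace MemorylessNetwork

variable {k N : ℕ} {net : MemorylessNetwork k N} {n : ℕ}

/-- The tuple `D` is nonnegative and is achieved by some scheme of block length `n`. -/
def Feasible (net : MemorylessNetwork k N) (n : ℕ) (P : Measure (Fin k → ℝ)) (D : Fin k → ℝ) :
    Prop :=
  (∀ m, 0 ≤ D m) ∧ ∃ C : net.CodingScheme n, ∀ m,
    ∫⁻ x, C.condDistortion m x ∂(Measure.pi fun _ => P) ≤ ENNReal.ofReal (n * D m)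

/-- The sign condition in `Feasible` replaces what `ENNReal.ofReal` forgets about a negative `D m`;
finiteness of the `lintegral` gives back integrability. -/
theorem achievable_iff_exists_feasible (net : MemorylessNetwork k N) (P : Measure (Fin k → ℝ))
    [IsProbabilityMeasure P] (D : Fin k → ℝ) :
    net.Achievable quadraticDistortion P D ↔ ∃ n, 0 < n ∧ net.Feasible n P D := by
  refine exists_congr fun n => and_congr_right fun hn => ?_
  have hn' : (0 : ℝ) < n := by exact_mod_cast hn
  constructor
  · rintro ⟨C, hC⟩
    have hle : ∀ m, ∫ p, C.distortion quadraticDistortion m p ∂(C.jointLaw P) ≤ n * D m := by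
      intro m
      have := (hC m).2
      rwa [one_div, inv_mul_le_iff₀ hn'] at this
    refine ⟨fun m => ?_, C, fun m => ?_⟩
    · have := (integral_nonneg (μ := C.jointLaw P) (C.distortion_nonneg m)).trans (hle m)
      exact nonneg_of_mul_nonneg_right this hn'
    · rw [C.lintegral_condDistortion, ← ofReal_integral_eq_lintegral_ofReal (hC m).1
        (.of_forall (C.distortion_nonneg m))]
      exact ENNReal.ofReal_le_ofReal (hle m)
  · rintro ⟨hD, C, hC⟩
    refine ⟨C, fun m => ?_⟩
    have h := hC m
    rw [C.lintegral_condDistortion] at h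
    have hint : Integrable (C.distortion quadraticDistortion m) (C.jointLaw P) := by
      refine ⟨(C.measurable_distortion m).aestronglyMeasurable, ?_⟩
      rw [hasFiniteIntegral_iff_ofReal (.of_forall (C.distortion_nonneg m))]
      exact h.trans_lt ENNReal.ofReal_lt_top
    refine ⟨hint, ?_⟩
    rw [one_div, inv_mul_le_iff₀ hn']
    rw [← ofReal_integral_eq_lintegral_ofReal hint (.of_forall (C.distortion_nonneg m))] at h
    exact (ENNReal.ofReal_le_ofReal_iff (mul_nonneg hn'.le (hD m))).1 h

theorem Feasible.mono {P : Measure (Fin k → ℝ)} {D D' : Fin k → ℝ} (h : net.Feasible n P D)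
    (hD : D ≤ D') : net.Feasible n P D' := by
  obtain ⟨h0, C, hC⟩ := h
  refine ⟨fun m => (h0 m).trans (hD m), C, fun m => (hC m).trans ?_⟩
  gcongr
  exact hD m

theorem Feasible.rotate {P : Measure (Fin k → ℝ)} [IsProbabilityMeasure P] {c s : ℝ}
    (hcs : c ^ 2 + s ^ 2 = 1) {D₁ D₂ : Fin k → ℝ} (h₁ : net.Feasible n (mix c s P P) D₁)
    (h₂ : net.Feasible n (mix (-s) c P P) D₂) :
    net.Feasible (n + n) P ((1 / 2 : ℝ) • (D₁ + D₂)) := by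
  obtain ⟨h₁, C₁, hC₁⟩ := h₁
  obtain ⟨h₂, C₂, hC₂⟩ := h₂
  refine ⟨fun m => ?_, C₁.rotate C₂ c s, fun m => ?_⟩
  · have := h₁ m
    have := h₂ m
    simp only [Pi.smul_apply, Pi.add_apply, smul_eq_mul]
    positivity
  · simp_rw [CodingScheme.condDistortion_rotate C₁ C₂ hcs]
    have hmeas : Measurable fun x => C₁.condDistortion m (combineHalves c s x) :=
      (C₁.measurable_condDistortion m).comp (measurePreserving_combineHalves n c s P).measurable
    rw [lintegral_add_left hmeas,
      (measurePreserving_combineHalves n c s P).lintegral_comp (C₁.measurable_condDistortion m),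
      (measurePreserving_combineHalves n (-s) c P).lintegral_comp
        (C₂.measurable_condDistortion m)]
    refine (add_le_add (hC₁ m) (hC₂ m)).trans ?_
    rw [← ENNReal.ofReal_add (mul_nonneg (by positivity) (h₁ m))
      (mul_nonneg (by positivity) (h₂ m))]
    refine ENNReal.ofReal_le_ofReal (le_of_eq ?_)
    simp only [Pi.smul_apply, Pi.add_apply, smul_eq_mul]
    push_cast
    ring

end MemorylessNetwork

theorem mix_one_zero {k : ℕ} (Q R : Measure (Fin k → ℝ)) [SFinite Q] [IsProbabilityMeasure R] :
    mix 1 0 Q R = Q := by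
  have : (fun p : (Fin k → ℝ) × (Fin k → ℝ) => (1 : ℝ) • p.1 + (0 : ℝ) • p.2) = Prod.fst := by
    ext; simp
  rw [mix, this, Measure.map_fst_prod]
  simp

theorem mix_zero_one {k : ℕ} (Q R : Measure (Fin k → ℝ)) [IsProbabilityMeasure Q] [SFinite R] :
    mix 0 1 Q R = R := by
  have : (fun p : (Fin k → ℝ) × (Fin k → ℝ) => (0 : ℝ) • p.1 + (1 : ℝ) • p.2) = Prod.snd := by
    ext; simp
  rw [mix, this, Measure.map_snd_prod]
  simp

namespace MemorylessNetwork

variable {k N : ℕ} {net : MemorylessNetwork k N} {n : ℕ}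

/-- The tuples which are feasible for some block length `n * 2 ^ r`. -/
def dyadicRegion (net : MemorylessNetwork k N) (n : ℕ) (P : Measure (Fin k → ℝ)) :
    Set (Fin k → ℝ) :=
  {D | ∃ r : ℕ, net.Feasible (n * 2 ^ r) P D}

/-- Time sharing is the rotation by angle zero: each scheme gets one unmixed half. -/
theorem Feasible.timeShare {P : Measure (Fin k → ℝ)} [IsProbabilityMeasure P]
    {D₁ D₂ : Fin k → ℝ} (h₁ : net.Feasible n P D₁) (h₂ : net.Feasible n P D₂) :
    net.Feasible (n + n) P ((1 / 2 : ℝ) • (D₁ + D₂)) := by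
  refine Feasible.rotate (c := 1) (s := 0) (by norm_num) ?_ ?_
  · rwa [mix_one_zero]
  · rwa [neg_zero, mix_zero_one]

theorem Feasible.mul_two_pow {P : Measure (Fin k → ℝ)} [IsProbabilityMeasure P]
    {D : Fin k → ℝ} (h : net.Feasible n P D) (r : ℕ) : net.Feasible (n * 2 ^ r) P D := by
  induction r with
  | zero => simpa using h
  | succ r ih =>
    have e : (1 / 2 : ℝ) • (D + D) = D := by module
    have := ih.timeShare ih
    rwa [e, ← mul_two, mul_assoc, ← pow_succ] at this

theorem Feasible.of_le {P : Measure (Fin k → ℝ)} [IsProbabilityMeasure P] {r s : ℕ} (hrs : r ≤ s)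
    {D : Fin k → ℝ} (h : net.Feasible (n * 2 ^ r) P D) : net.Feasible (n * 2 ^ s) P D := by
  have := h.mul_two_pow (s - r)
  rwa [mul_assoc, ← pow_add, Nat.add_sub_cancel' hrs] at this

theorem dyadicRegion_rotate {P : Measure (Fin k → ℝ)} [IsProbabilityMeasure P] {c s : ℝ}
    (hcs : c ^ 2 + s ^ 2 = 1) {D₁ D₂ : Fin k → ℝ} (h₁ : D₁ ∈ net.dyadicRegion n (mix c s P P))
    (h₂ : D₂ ∈ net.dyadicRegion n (mix (-s) c P P)) :
    (1 / 2 : ℝ) • (D₁ + D₂) ∈ net.dyadicRegion n P := by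
  obtain ⟨r₁, h₁⟩ := h₁
  obtain ⟨r₂, h₂⟩ := h₂
  refine ⟨max r₁ r₂ + 1, ?_⟩
  have := (h₁.of_le (le_max_left r₁ r₂)).rotate hcs (h₂.of_le (le_max_right r₁ r₂))
  rwa [← mul_two, mul_assoc, ← pow_succ] at this

theorem dyadicRegion_midpoint {P : Measure (Fin k → ℝ)} [IsProbabilityMeasure P]
    {D₁ D₂ : Fin k → ℝ} (h₁ : D₁ ∈ net.dyadicRegion n P) (h₂ : D₂ ∈ net.dyadicRegion n P) :
    (1 / 2 : ℝ) • (D₁ + D₂) ∈ net.dyadicRegion n P := by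
  refine dyadicRegion_rotate (c := 1) (s := 0) (by norm_num) ?_ ?_
  · rwa [mix_one_zero]
  · rwa [neg_zero, mix_zero_one]

theorem convex_closure_dyadicRegion (net : MemorylessNetwork k N) (n : ℕ)
    (P : Measure (Fin k → ℝ)) [IsProbabilityMeasure P] :
    Convex ℝ (closure (net.dyadicRegion n P)) := by
  refine convex_of_isClosed_of_midpoint_mem isClosed_closure fun x hx y hy => ?_
  exact map_mem_closure₂ (f := fun x y : Fin k → ℝ => (1 / 2 : ℝ) • (x + y)) (by fun_prop) hx hy
    fun a ha b hb => dyadicRegion_midpoint ha hb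

/-- Feasibility is monotone in the tuple, so a slack of `ε` absorbs an approximation in the sup
norm. -/
theorem add_mem_dyadicRegion_of_mem_closure {P : Measure (Fin k → ℝ)} [IsProbabilityMeasure P]
    {D D' : Fin k → ℝ} (h : D ∈ closure (net.dyadicRegion n P)) {ε : ℝ} (hε : 0 < ε)
    (hD : ∀ m, D m + ε ≤ D' m) : D' ∈ net.dyadicRegion n P := by
  obtain ⟨E, ⟨r, hE⟩, hdist⟩ := Metric.mem_closure_iff.1 h ε hε
  refine ⟨r, hE.mono fun m => ?_⟩
  have := (dist_le_pi_dist D E m).trans_lt hdist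
  rw [Real.dist_eq] at this
  linarith [(abs_lt.1 this).1, hD m]

/-- Time sharing over the realizations of a random coding scheme. -/
theorem add_mem_dyadicRegion_of_random {Q : Measure (Fin k → ℝ)} [IsProbabilityMeasure Q]
    {Ω : Type*} [MeasurableSpace Ω] (ν : Measure Ω) [IsProbabilityMeasure ν]
    (C : Ω → net.CodingScheme n) (hn : 0 < n) {D : Fin k → ℝ}
    (hmeas : ∀ m, Measurable fun ω => ∫⁻ x, (C ω).condDistortion m x ∂(Measure.pi fun _ => Q))
    (h : ∀ m, ∫⁻ ω, ∫⁻ x, (C ω).condDistortion m x ∂(Measure.pi fun _ => Q) ∂ν ≤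
      ENNReal.ofReal (n * D m)) (hD : ∀ m, 0 ≤ D m) {ε : ℝ} (hε : 0 < ε) :
    (fun m => D m + ε) ∈ net.dyadicRegion n Q := by
  have hn' : (0 : ℝ) < n := by exact_mod_cast hn
  set F : Fin k → Ω → ENNReal :=
    fun m ω => ∫⁻ x, (C ω).condDistortion m x ∂(Measure.pi fun _ => Q) with hF
  have hfin : ∀ m, ∫⁻ ω, F m ω ∂ν ≠ ⊤ := fun m => ((h m).trans_lt ENNReal.ofReal_lt_top).ne
  have hae : ∀ᵐ ω ∂ν, ∀ m, F m ω < ⊤ := ae_all_iff.2 fun m => ae_lt_top (hmeas m) (hfin m)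
  let f : Ω → Fin k → ℝ := fun ω m => (n : ℝ)⁻¹ * (F m ω).toReal
  have hint : ∀ m, Integrable (fun ω => f ω m) ν := fun m =>
    (integrable_toReal_of_lintegral_ne_top (hmeas m).aemeasurable (hfin m)).const_mul _
  -- No single realization need be good for all `m` at once, so none is selected: the mean tuple is
  -- a barycenter of feasible tuples and stays in the closed convex hull.
  have hmem : ∫ ω, f ω ∂ν ∈ closure (net.dyadicRegion n Q) := by
    refine (convex_closure_dyadicRegion net n Q).integral_mem isClosed_closure ?_
      (Integrable.of_eval hint)
    filter_upwards [hae] with ω hω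
    refine subset_closure ⟨0, ?_⟩
    rw [pow_zero, mul_one]
    refine ⟨fun m => by positivity, C ω, fun m => ?_⟩
    rw [← mul_assoc, mul_inv_cancel₀ hn'.ne', one_mul, ENNReal.ofReal_toReal (hω m).ne]
  refine add_mem_dyadicRegion_of_mem_closure hmem hε fun m => ?_
  gcongr
  rw [eval_integral hint, integral_const_mul, inv_mul_le_iff₀ hn',
    integral_toReal (hmeas m).aemeasurable (hae.mono fun ω hω => hω m)]
  exact ENNReal.toReal_le_of_le_ofReal (mul_nonneg hn'.le (hD m)) (h m)

/-- `Q` is one of the `2 ^ r` laws which arise from `P` by `r` steps, each of which replaces the law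
of `X` by the law of `c X + c X'` or of `-c X + c X'`, where `c = 1 / √2` and `X'` is an independent
copy of `X`. -/
def IsButterflyLeaf : ℕ → Measure (Fin k → ℝ) → Measure (Fin k → ℝ) → Prop
  | 0, P, Q => Q = P
  | r + 1, P, Q => IsButterflyLeaf r (mix (√2)⁻¹ (√2)⁻¹ P P) Q ∨
      IsButterflyLeaf r (mix (-(√2)⁻¹) (√2)⁻¹ P P) Q

/-- Undoing the butterfly from the leaves loses nothing, since the average of `D` and `D` is `D`. -/
theorem mem_dyadicRegion_of_forall_leaf {D : Fin k → ℝ} (r : ℕ) (P : Measure (Fin k → ℝ))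
    [IsProbabilityMeasure P] (h : ∀ Q, IsButterflyLeaf r P Q → D ∈ net.dyadicRegion n Q) :
    D ∈ net.dyadicRegion n P := by
  induction r generalizing P with
  | zero => exact h P rfl
  | succ r ih =>
    have hcs : ((√2)⁻¹ : ℝ) ^ 2 + ((√2)⁻¹ : ℝ) ^ 2 = 1 := by
      rw [inv_pow, Real.sq_sqrt (by norm_num)]; norm_num
    have := dyadicRegion_rotate hcs (ih _ fun Q hQ => h Q (Or.inl hQ))
      (ih _ fun Q hQ => h Q (Or.inr hQ))
    have e : (1 / 2 : ℝ) • (D + D) = D := by module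
    rwa [e] at this

end MemorylessNetwork

/-! ### Centered laws with a given covariance matrix. -/

/-- The law `Q` has finite second moments, mean zero and covariance matrix `K`. -/
structure IsCentered {k : ℕ} (Q : Measure (Fin k → ℝ)) (K : Matrix (Fin k) (Fin k) ℝ) : Prop where
  memLp : ∀ i, MemLp (fun x : Fin k → ℝ => x i) 2 Q
  mean : ∀ i, ∫ x, x i ∂Q = 0
  second : ∀ i j, ∫ x, x i * x j ∂Q = K i j

section Centered

variable {k : ℕ} {Q R : Measure (Fin k → ℝ)} {K : Matrix (Fin k) (Fin k) ℝ}

theorem ContinuousLinearMap.apply_eq_sum (L : StrongDual ℝ (Fin k → ℝ)) (x : Fin k → ℝ) :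
    L x = ∑ i, L (Pi.single i 1) * x i := by
  rw [← ContinuousLinearMap.coe_coe, LinearMap.pi_apply_eq_sum_univ (L : (Fin k → ℝ) →ₗ[ℝ] ℝ) x]
  refine Finset.sum_congr rfl fun i _ => ?_
  rw [smul_eq_mul, mul_comm]
  congr 2
  ext j
  simp [Pi.single_apply, eq_comm]

namespace IsCentered

theorem memLp_dual (h : IsCentered Q K) (L : StrongDual ℝ (Fin k → ℝ)) : MemLp L 2 Q := by
  have : ⇑L = fun x => ∑ i, L (Pi.single i 1) * x i := funext fun x => L.apply_eq_sum x
  rw [this]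
  exact memLp_finsetSum _ fun i _ => (h.memLp i).const_mul _

theorem integral_dual [IsFiniteMeasure Q] (h : IsCentered Q K) (L : StrongDual ℝ (Fin k → ℝ)) :
    ∫ x, L x ∂Q = 0 := by
  rw [funext fun x => L.apply_eq_sum x, integral_finsetSum _ fun i _ => ((h.memLp i).integrable one_le_two).const_mul _]
  simp [integral_const_mul, h.mean]

theorem integral_dual_mul (h : IsCentered Q K) (L L' : StrongDual ℝ (Fin k → ℝ)) :
    ∫ x, L x * L' x ∂Q =
      ∑ i, ∑ j, L (Pi.single i 1) * L' (Pi.single j 1) * K i j := by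
  have e : ∀ x : Fin k → ℝ, L x * L' x =
      ∑ i, ∑ j, L (Pi.single i 1) * L' (Pi.single j 1) * (x i * x j) := by
    intro x
    rw [L.apply_eq_sum x, L'.apply_eq_sum x, Finset.sum_mul_sum]
    exact Finset.sum_congr rfl fun i _ => Finset.sum_congr rfl fun j _ => by ring
  simp_rw [e]
  have hint : ∀ i j, Integrable (fun x : Fin k → ℝ =>
      L (Pi.single i 1) * L' (Pi.single j 1) * (x i * x j)) Q :=
    fun i j => ((h.memLp i).integrable_mul (h.memLp j)).const_mul _
  rw [integral_finsetSum _ fun i _ => integrable_finsetSum _ fun j _ => hint i j]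
  refine Finset.sum_congr rfl fun i _ => ?_
  rw [integral_finsetSum _ fun j _ => hint i j]
  exact Finset.sum_congr rfl fun j _ => by rw [integral_const_mul, h.second]

theorem map [IsFiniteMeasure Q] (h : IsCentered Q K) {l : ℕ} (T : (Fin k → ℝ) →L[ℝ] (Fin l → ℝ))
    {K' : Matrix (Fin l) (Fin l) ℝ}
    (hK : ∀ i j, ∑ a, ∑ b, T (Pi.single a 1) i * T (Pi.single b 1) j * K a b = K' i j) :
    IsCentered (Q.map T) K' where
  memLp i := by
    rw [memLp_map_measure_iff (Measurable.aestronglyMeasurable (by fun_prop)) (by fun_prop)]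
    exact h.memLp_dual ((ContinuousLinearMap.proj i).comp T)
  mean i := by
    rw [integral_map (by fun_prop) (Measurable.aestronglyMeasurable (by fun_prop))]
    exact h.integral_dual ((ContinuousLinearMap.proj i).comp T)
  second i j := by
    rw [integral_map (by fun_prop)
      (Measurable.aestronglyMeasurable (by fun_prop)), ← hK]
    exact h.integral_dual_mul ((ContinuousLinearMap.proj i).comp T)
      ((ContinuousLinearMap.proj j).comp T)

/-- Independence and zero means kill the cross moments, which leaves `(c ^ 2 + s ^ 2) K`. -/
theorem mix [IsProbabilityMeasure Q] [IsProbabilityMeasure R] (hQ : IsCentered Q K)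
    (hR : IsCentered R K) {c s : ℝ} (hcs : c ^ 2 + s ^ 2 = 1) : IsCentered (mix c s Q R) K := by
  have hf : ∀ i, MemLp (fun p : (Fin k → ℝ) × (Fin k → ℝ) => p.1 i) 2 (Q.prod R) := fun i =>
    (hQ.memLp i).comp_fst R
  have hs : ∀ i, MemLp (fun p : (Fin k → ℝ) × (Fin k → ℝ) => p.2 i) 2 (Q.prod R) := fun i =>
    (hR.memLp i).comp_snd Q
  constructor
  · intro i
    rw [_root_.mix, memLp_map_measure_iff (Measurable.aestronglyMeasurable (by fun_prop)) (by fun_prop)]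
    exact ((hf i).const_mul c).add ((hs i).const_mul s)
  · intro i
    rw [_root_.mix, integral_map (by fun_prop) (Measurable.aestronglyMeasurable (by fun_prop))]
    simp only [Pi.add_apply, Pi.smul_apply, smul_eq_mul]
    rw [integral_add (((hf i).integrable one_le_two).const_mul c)
      (((hs i).integrable one_le_two).const_mul s), integral_const_mul, integral_const_mul,
      integral_fun_fst (fun x : Fin k → ℝ => x i), integral_fun_snd (fun x : Fin k → ℝ => x i),
      hQ.mean, hR.mean]
    simp
  · intro i j
    rw [_root_.mix, integral_map (by fun_prop)
      (Measurable.aestronglyMeasurable (by fun_prop))]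
    have e : ∀ p : (Fin k → ℝ) × (Fin k → ℝ), (c • p.1 + s • p.2) i * (c • p.1 + s • p.2) j =
        c ^ 2 * (p.1 i * p.1 j) + s ^ 2 * (p.2 i * p.2 j) +
          (c * s * (p.1 i * p.2 j) + c * s * (p.1 j * p.2 i)) := by
      intro p
      simp only [Pi.add_apply, Pi.smul_apply, smul_eq_mul]
      ring
    simp_rw [e]
    have h1 : Integrable (fun p : (Fin k → ℝ) × (Fin k → ℝ) => c ^ 2 * (p.1 i * p.1 j)) (Q.prod R) :=
      ((hf i).integrable_mul (hf j)).const_mul (c ^ 2)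
    have h2 : Integrable (fun p : (Fin k → ℝ) × (Fin k → ℝ) => s ^ 2 * (p.2 i * p.2 j)) (Q.prod R) :=
      ((hs i).integrable_mul (hs j)).const_mul (s ^ 2)
    have h3 : Integrable (fun p : (Fin k → ℝ) × (Fin k → ℝ) => c * s * (p.1 i * p.2 j)) (Q.prod R) :=
      ((hf i).integrable_mul (hs j)).const_mul (c * s)
    have h4 : Integrable (fun p : (Fin k → ℝ) × (Fin k → ℝ) => c * s * (p.1 j * p.2 i)) (Q.prod R) :=
      ((hf j).integrable_mul (hs i)).const_mul (c * s)
    have h12 : Integrable (fun p : (Fin k → ℝ) × (Fin k → ℝ) =>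
        c ^ 2 * (p.1 i * p.1 j) + s ^ 2 * (p.2 i * p.2 j)) (Q.prod R) := h1.add h2
    have h34 : Integrable (fun p : (Fin k → ℝ) × (Fin k → ℝ) =>
        c * s * (p.1 i * p.2 j) + c * s * (p.1 j * p.2 i)) (Q.prod R) := h3.add h4
    rw [integral_add h12 h34, integral_add h1 h2, integral_add h3 h4]
    simp only [integral_const_mul]
    rw [integral_fun_fst (fun x : Fin k → ℝ => x i * x j),
      integral_fun_snd (fun x : Fin k → ℝ => x i * x j),
      integral_prod_mul (fun x : Fin k → ℝ => x i) (fun x : Fin k → ℝ => x j),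
      integral_prod_mul (fun x : Fin k → ℝ => x j) (fun x : Fin k → ℝ => x i),
      hQ.mean, hQ.mean, hQ.second, hR.second]
    simp only [probReal_univ, one_smul]
    linear_combination K i j * hcs

theorem charFunDual_gaussian [IsGaussian Q] (h : IsCentered Q K) (L : StrongDual ℝ (Fin k → ℝ)) :
    charFunDual Q L = Complex.exp
      (-(∑ i, ∑ j, L (Pi.single i 1) * L (Pi.single j 1) * K i j : ℝ) / 2) := by
  have hv : Var[L; Q] = ∑ i, ∑ j, L (Pi.single i 1) * L (Pi.single j 1) * K i j := by
    rw [variance_of_integral_eq_zero (by fun_prop) (h.integral_dual L), ← h.integral_dual_mul]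
    exact integral_congr_ae (.of_forall fun x => sq (L x))
  rw [IsGaussian.charFunDual_eq, hv, integral_complex_ofReal, h.integral_dual]
  simp [neg_div]

theorem eq_of_isGaussian [IsGaussian Q] [IsGaussian R] (hQ : IsCentered Q K)
    (hR : IsCentered R K) : Q = R := by
  refine Measure.ext_of_charFunDual (funext fun L => ?_)
  rw [hQ.charFunDual_gaussian, hR.charFunDual_gaussian]

/-- The Gaussian law is the fixed point of the butterfly step: the mixture is Gaussian, centered,
and has the same covariance. -/
theorem mix_self [IsGaussian Q] (hQ : IsCentered Q K) {c s : ℝ} (hcs : c ^ 2 + s ^ 2 = 1) :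
    _root_.mix c s Q Q = Q := by
  have e : _root_.mix c s Q Q = (Q.prod Q).map (c • ContinuousLinearMap.fst ℝ (Fin k → ℝ)
    (Fin k → ℝ) + s • ContinuousLinearMap.snd ℝ (Fin k → ℝ) (Fin k → ℝ)) := rfl
  have : IsGaussian (_root_.mix c s Q Q) := by rw [e]; infer_instance
  exact (hQ.mix hQ hcs).eq_of_isGaussian hQ

end IsCentered

theorem charFunDual_mix [IsProbabilityMeasure Q] [IsProbabilityMeasure R] (c s : ℝ)
    (L : StrongDual ℝ (Fin k → ℝ)) :
    charFunDual (mix c s Q R) L = charFunDual Q (c • L) * charFunDual R (s • L) := by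
  have e : mix c s Q R = (Q.prod R).map (c • ContinuousLinearMap.fst ℝ (Fin k → ℝ)
    (Fin k → ℝ) + s • ContinuousLinearMap.snd ℝ (Fin k → ℝ) (Fin k → ℝ)) := rfl
  rw [e, charFunDual_map, charFunDual_prod]
  congr 2 <;> ext <;> simp

end Centered

/-! ### Central limit theorem for butterfly leaves. -/

theorem charFun_sub_isLittleO {μ ν : Measure ℝ} [IsProbabilityMeasure μ] [IsProbabilityMeasure ν]
    (hμ : MemLp id 2 μ) (hν : MemLp id 2 ν) (h1 : ∫ x, x ∂μ = ∫ x, x ∂ν)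
    (h2 : ∫ x, x ^ 2 ∂μ = ∫ x, x ^ 2 ∂ν) :
    (fun t => charFun μ t - charFun ν t) =o[𝓝 0] fun t => t ^ 2 := by
  have key : ∀ ρ : Measure ℝ, IsProbabilityMeasure ρ → MemLp id 2 ρ →
      (fun t => charFun ρ t - taylorWithinEval (charFun ρ) 2 Set.univ 0 t) =o[𝓝 0]
        fun t => t ^ 2 := by
    intro ρ _ hρ
    have := taylor_isLittleO_univ (x₀ := (0 : ℝ)) (contDiff_charFun (n := 2) hρ)
    simpa using this
  -- The second-order Taylor polynomials at 0 depend on the first two moments only, so they cancel.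
  refine ((key μ inferInstance hμ).sub (key ν inferInstance hν)).congr_left fun t => ?_
  rw [taylorWithinEval_charFun_zero (n := 2) (by exact_mod_cast hμ),
    taylorWithinEval_charFun_zero (n := 2) (by exact_mod_cast hν)]
  simp [Finset.sum_range_succ, h1, h2]

section CentralLimit

variable {k : ℕ}

theorem charFunDual_neg_eq_conj {E : Type*} [NormedAddCommGroup E] [NormedSpace ℝ E]
    [MeasurableSpace E] (μ : Measure E) (L : StrongDual ℝ E) :
    charFunDual μ (-L) = (starRingEnd ℂ) (charFunDual μ L) := by
  rw [charFunDual_apply, charFunDual_apply, ← integral_conj]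
  refine integral_congr_ae (.of_forall fun x => ?_)
  simp [← Complex.exp_conj]

theorem norm_charFunDual_le_one {E : Type*} [NormedAddCommGroup E] [NormedSpace ℝ E]
    [MeasurableSpace E] (μ : Measure E) [IsProbabilityMeasure μ] (L : StrongDual ℝ E) :
    ‖charFunDual μ L‖ ≤ 1 := by
  rw [charFunDual_apply]
  refine (norm_integral_le_of_norm_le_const (C := 1) (.of_forall fun x => ?_)).trans (by simp)
  simp [Complex.norm_exp]

theorem norm_mul_sub_mul_le {a b c d : ℂ} (hb : ‖b‖ ≤ 1) (hc : ‖c‖ ≤ 1) :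
    ‖a * b - c * d‖ ≤ ‖a - c‖ + ‖b - d‖ := by
  have e : a * b - c * d = (a - c) * b + c * (b - d) := by ring
  rw [e]
  refine (norm_add_le _ _).trans ?_
  rw [norm_mul, norm_mul]
  gcongr
  · exact mul_le_of_le_one_right (norm_nonneg _) hb
  · exact mul_le_of_le_one_left (norm_nonneg _) hc

namespace MemorylessNetwork.IsButterflyLeaf

variable {K : Matrix (Fin k) (Fin k) ℝ}

theorem inv_sqrt_two_sq : ((√2)⁻¹ : ℝ) ^ 2 + ((√2)⁻¹ : ℝ) ^ 2 = 1 := by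
  rw [inv_pow, Real.sq_sqrt (by norm_num)]; norm_num

theorem isProbabilityMeasure {r : ℕ} {P Q : Measure (Fin k → ℝ)} [IsProbabilityMeasure P]
    (h : IsButterflyLeaf r P Q) : IsProbabilityMeasure Q := by
  induction r generalizing P with
  | zero => rw [show Q = P from h]; infer_instance
  | succ r ih => exact h.elim (fun h => ih h) fun h => ih h

theorem isCentered {r : ℕ} {P Q : Measure (Fin k → ℝ)} [IsProbabilityMeasure P]
    (h : IsButterflyLeaf r P Q) (hP : IsCentered P K) : IsCentered Q K := by
  induction r generalizing P with
  | zero => rwa [show Q = P from h]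
  | succ r ih =>
    exact h.elim (fun h => ih h (hP.mix hP inv_sqrt_two_sq))
      fun h => ih h (hP.mix hP (by rw [neg_sq]; exact inv_sqrt_two_sq))

/-- Writing `G` as its own mixture turns each step into a difference of two products of numbers in
the unit disc, which at most doubles the distance. The minus sign only conjugates characteristic
functions, so all leaves obey one bound. -/
theorem norm_charFunDual_sub_le {r : ℕ} {P Q G : Measure (Fin k → ℝ)} [IsProbabilityMeasure P]
    [IsGaussian G] (hG : IsCentered G K) (h : IsButterflyLeaf r P Q)
    (L : StrongDual ℝ (Fin k → ℝ)) :
    ‖charFunDual Q L - charFunDual G L‖ ≤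
      2 ^ r * ‖charFunDual P (((√2)⁻¹ : ℝ) ^ r • L) - charFunDual G (((√2)⁻¹ : ℝ) ^ r • L)‖ := by
  induction r generalizing P with
  | zero => rw [show Q = P from h]; simp
  | succ r ih =>
    set c : ℝ := (√2)⁻¹ with hc
    have hc2 : c ^ 2 + c ^ 2 = 1 := inv_sqrt_two_sq
    have key : ∀ M : StrongDual ℝ (Fin k → ℝ),
        ‖charFunDual (mix c c P P) M - charFunDual G M‖ ≤
          2 * ‖charFunDual P (c • M) - charFunDual G (c • M)‖ ∧
        ‖charFunDual (mix (-c) c P P) M - charFunDual G M‖ ≤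
          2 * ‖charFunDual P (c • M) - charFunDual G (c • M)‖ := by
      intro M
      constructor
      · rw [← congrArg (charFunDual · M) (hG.mix_self hc2), charFunDual_mix, charFunDual_mix,
          two_mul]
        exact norm_mul_sub_mul_le (norm_charFunDual_le_one _ _) (norm_charFunDual_le_one _ _)
      · rw [← congrArg (charFunDual · M) (hG.mix_self (c := -c) (s := c) (by rwa [neg_sq])),
          charFunDual_mix, charFunDual_mix, two_mul]
        refine (norm_mul_sub_mul_le (norm_charFunDual_le_one _ _)
          (norm_charFunDual_le_one _ _)).trans (le_of_eq ?_)
        have hneg : (-c) • M = -(c • M) := by ext; simp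
        rw [hneg, charFunDual_neg_eq_conj, charFunDual_neg_eq_conj, ← map_sub, RCLike.norm_conj]
    have e : c • c ^ r • L = c ^ (r + 1) • L := by rw [smul_smul, pow_succ']
    have h2 : (2 : ℝ) ^ (r + 1) = 2 ^ r * 2 := pow_succ 2 r
    rw [h2, mul_assoc, ← e]
    rcases h with h | h
    · exact (ih h).trans (by gcongr; exact (key _).1)
    · exact (ih h).trans (by gcongr; exact (key _).2)

end MemorylessNetwork.IsButterflyLeaf

open MemorylessNetwork

theorem tendsto_charFunDual_butterflyLeaf {K : Matrix (Fin k) (Fin k) ℝ}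
    {P G : Measure (Fin k → ℝ)} [IsProbabilityMeasure P] [IsGaussian G] (hP : IsCentered P K)
    (hG : IsCentered G K) {Q : ℕ → Measure (Fin k → ℝ)} (hQ : ∀ r, IsButterflyLeaf r P (Q r))
    (L : StrongDual ℝ (Fin k → ℝ)) :
    Tendsto (fun r => charFunDual (Q r) L) atTop (𝓝 (charFunDual G L)) := by
  rw [tendsto_iff_norm_sub_tendsto_zero]
  set c : ℝ := (√2)⁻¹ with hc
  have hc2 : c ^ 2 = 1 / 2 := by linarith [IsButterflyLeaf.inv_sqrt_two_sq]
  have hc0 : 0 < c := by positivity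
  have hc1 : c < 1 := by nlinarith
  have hmem : ∀ R : Measure (Fin k → ℝ), IsCentered R K → MemLp id 2 (R.map L) := by
    intro R hR
    rw [memLp_map_measure_iff (by fun_prop) (by fun_prop)]
    exact hR.memLp_dual L
  have hmean : ∀ R : Measure (Fin k → ℝ), IsProbabilityMeasure R → IsCentered R K →
      ∫ x, x ∂(R.map L) = 0 := by
    intro R _ hR
    rw [integral_map (by fun_prop) (Measurable.aestronglyMeasurable (by fun_prop))]
    exact hR.integral_dual L
  have hsq : ∀ R : Measure (Fin k → ℝ), IsCentered R K → ∫ x, x ^ 2 ∂(R.map L) =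
      ∑ i, ∑ j, L (Pi.single i 1) * L (Pi.single j 1) * K i j := by
    intro R hR
    rw [integral_map (by fun_prop) (Measurable.aestronglyMeasurable (by fun_prop)),
      ← hR.integral_dual_mul]
    exact integral_congr_ae (.of_forall fun x => sq (L x))
  have : IsProbabilityMeasure (P.map L) := Measure.isProbabilityMeasure_map (by fun_prop)
  have : IsProbabilityMeasure (G.map L) := Measure.isProbabilityMeasure_map (by fun_prop)
  have ho := charFun_sub_isLittleO (hmem P hP) (hmem G hG)
    (by rw [hmean P inferInstance hP, hmean G inferInstance hG]) (by rw [hsq P hP, hsq G hG])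
  have ht : Tendsto (fun r : ℕ => c ^ r) atTop (𝓝 0) := tendsto_pow_atTop_nhds_zero_of_lt_one
    hc0.le hc1
  have hlim := (ho.comp_tendsto ht).norm_left.tendsto_div_nhds_zero
  refine squeeze_zero (fun _ => norm_nonneg _)
    (fun r => (hQ r).norm_charFunDual_sub_le hG L) (hlim.congr fun r => ?_)
  simp only [Function.comp_apply, charFun_map_eq_charFunDual_smul]
  -- Since `c ^ 2 = 1 / 2`, the factor `2 ^ r` is exactly `1 / (c ^ r) ^ 2` and is beaten by the
  -- `o(t ^ 2)` at `t = c ^ r`.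
  rw [← pow_mul, mul_comm r 2, pow_mul, hc2, div_pow, one_pow, one_div, div_inv_eq_mul, mul_comm]

/-- Lévy's continuity theorem, transported to `EuclideanSpace`, where every vector gives a dual
element through the inner product. -/
theorem tendsto_integral_of_tendsto_charFunDual {Q : ℕ → Measure (Fin k → ℝ)}
    {G : Measure (Fin k → ℝ)} [hQ : ∀ r, IsProbabilityMeasure (Q r)] [IsProbabilityMeasure G]
    (h : ∀ L, Tendsto (fun r => charFunDual (Q r) L) atTop (𝓝 (charFunDual G L)))
    (f : BoundedContinuousFunction (Fin k → ℝ) ℝ) :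
    Tendsto (fun r => ∫ x, f x ∂(Q r)) atTop (𝓝 (∫ x, f x ∂G)) := by
  let e : (Fin k → ℝ) ≃L[ℝ] EuclideanSpace ℝ (Fin k) := (EuclideanSpace.equiv (Fin k) ℝ).symm
  have hprob : ∀ R : Measure (Fin k → ℝ), IsProbabilityMeasure R →
      IsProbabilityMeasure (R.map e) := fun R _ => Measure.isProbabilityMeasure_map (by fun_prop)
  have hchar : ∀ (R : Measure (Fin k → ℝ)) (t : EuclideanSpace ℝ (Fin k)),
      charFun (R.map e) t = charFunDual R
        ((InnerProductSpace.toDualMap ℝ _ t).comp (e : (Fin k → ℝ) →L[ℝ] _)) := by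
    intro R t
    rw [charFun_eq_charFunDual_toDualMap,
      ← charFunDual_map (e : (Fin k → ℝ) →L[ℝ] EuclideanSpace ℝ (Fin k))]
    rfl
  let law : (R : Measure (Fin k → ℝ)) → IsProbabilityMeasure R →
      ProbabilityMeasure (EuclideanSpace ℝ (Fin k)) := fun R hR => ⟨R.map e, hprob R hR⟩
  have hconv : Tendsto (fun r => law (Q r) (hQ r)) atTop (𝓝 (law G inferInstance)) := by
    refine ProbabilityMeasure.tendsto_iff_tendsto_charFun.2 fun t => ?_
    simp only [law, ProbabilityMeasure.coe_mk, hchar]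
    exact h _
  have := ProbabilityMeasure.tendsto_iff_forall_integral_tendsto.1 hconv
    (f.compContinuous ⟨e.symm, e.symm.continuous⟩)
  simp only [law, ProbabilityMeasure.coe_mk] at this
  have hint : ∀ R : Measure (Fin k → ℝ), ∫ y, f.compContinuous ⟨e.symm, e.symm.continuous⟩ y
      ∂(R.map e) = ∫ x, f x ∂(R) := by
    intro R
    rw [integral_map (by fun_prop) (Continuous.aestronglyMeasurable (map_continuous _))]
    simp
  simpa only [hint] using this

end CentralLimit

/-! ### Densities of product measures. -/

section ProductDensity

theorem lintegral_fin_nat_prod_eq_prod {n : ℕ} {E : Type*} [MeasurableSpace E]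
    (μ : Fin n → Measure E) [∀ i, SigmaFinite (μ i)] {f : Fin n → E → ENNReal}
    (hf : ∀ i, Measurable (f i)) :
    ∫⁻ x : Fin n → E, ∏ i, f i (x i) ∂(Measure.pi μ) = ∏ i, ∫⁻ x, f i x ∂(μ i) := by
  induction n with
  | zero => simp
  | succ n ih =>
    rw [← ((measurePreserving_piFinSuccAbove μ 0).symm).lintegral_comp_emb
      (MeasurableEquiv.measurableEmbedding _)]
    have e : ∀ p : E × (Fin n → E),
        ∏ i, f i ((MeasurableEquiv.piFinSuccAbove (fun _ => E) 0).symm p i) =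
          f 0 p.1 * ∏ i : Fin n, f i.succ (p.2 i) := by
      intro p
      rw [Fin.prod_univ_succ]
      rfl
    simp_rw [e]
    have hmeas : Measurable fun y : Fin n → E => ∏ i : Fin n, f i.succ (y i) :=
      Finset.measurable_prod _ fun i _ => (hf i.succ).comp (measurable_pi_apply i)
    rw [lintegral_prod_mul (g := fun y : Fin n → E => ∏ i : Fin n, f i.succ (y i))
      (hf 0).aemeasurable hmeas.aemeasurable, Fin.prod_univ_succ]
    congr 1
    exact ih (fun i => μ i.succ) fun i => hf i.succ

theorem pi_withDensity {n : ℕ} {E : Type*} [MeasurableSpace E]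
    (μ : Fin n → Measure E) [∀ i, SigmaFinite (μ i)] {f : Fin n → E → ENNReal}
    (hf : ∀ i, Measurable (f i)) [∀ i, SigmaFinite ((μ i).withDensity (f i))] :
    Measure.pi (fun i => (μ i).withDensity (f i)) =
      (Measure.pi μ).withDensity fun x => ∏ i, f i (x i) := by
  classical
  refine Measure.pi_eq fun s hs => ?_
  rw [withDensity_apply _ (MeasurableSet.univ_pi hs),
    ← lintegral_indicator (MeasurableSet.univ_pi hs)]
  have e : ∀ x : Fin n → E, (Set.univ.pi s).indicator (fun x => ∏ i, f i (x i)) x =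
      ∏ i, (s i).indicator (f i) (x i) := by
    intro x
    by_cases hx : x ∈ Set.univ.pi s
    · rw [Set.indicator_of_mem hx]
      exact Finset.prod_congr rfl fun i _ =>
        (Set.indicator_of_mem (hx i (Set.mem_univ i)) (f i)).symm
    · rw [Set.indicator_of_notMem hx]
      obtain ⟨i, hi⟩ : ∃ i, x i ∉ s i := by simpa [Set.mem_pi] using hx
      exact (Finset.prod_eq_zero (Finset.mem_univ i) (Set.indicator_of_notMem hi (f i))).symm
  simp_rw [e]
  rw [lintegral_fin_nat_prod_eq_prod μ fun i => (hf i).indicator (hs i)]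
  refine Finset.prod_congr rfl fun i _ => ?_
  rw [lintegral_indicator (hs i), withDensity_apply _ (hs i)]

end ProductDensity

/-! ### Factoring a possibly singular covariance matrix. -/

section Factorization

variable {k d : ℕ} {K : Matrix (Fin k) (Fin k) ℝ}

/-- The linear map which sends the `l`-th basis vector to `v l`. -/
noncomputable def combineCLM (v : Fin d → Fin k → ℝ) : (Fin d → ℝ) →L[ℝ] (Fin k → ℝ) :=
  ∑ l, (ContinuousLinearMap.proj l : (Fin d → ℝ) →L[ℝ] ℝ).smulRight (v l)

theorem combineCLM_single (v : Fin d → Fin k → ℝ) (l : Fin d) :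
    combineCLM v (Pi.single l 1) = v l := by
  simp [combineCLM, Pi.single_apply]

/-- `K` is positive semidefinite because its quadratic form is a second moment. The factor gives
coordinates in which smoothed laws have densities even if `K` is singular. -/
theorem IsCentered.exists_eq_sum_mul {G : Measure (Fin k → ℝ)} (h : IsCentered G K) :
    ∃ (d : ℕ) (v : Fin d → Fin k → ℝ), ∀ i j, K i j = ∑ l, v l i * v l j := by
  have hK : K.PosSemidef := by
    rw [Matrix.posSemidef_iff_dotProduct_mulVec]
    refine ⟨?_, fun x => ?_⟩
    · ext i j
      simp only [Matrix.conjTranspose_apply, star_trivial]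
      rw [← h.second, ← h.second]
      simp_rw [mul_comm]
    · let L : StrongDual ℝ (Fin k → ℝ) := ∑ i, x i • ContinuousLinearMap.proj i
      have hL : ∀ i, L (Pi.single i 1) = x i := fun i => by simp [L, Pi.single_apply]
      have := h.integral_dual_mul L L
      simp_rw [hL] at this
      have e : star x ⬝ᵥ K.mulVec x = ∑ i, ∑ j, x i * x j * K i j := by
        simp only [dotProduct, Matrix.mulVec, star_trivial, Finset.mul_sum]
        exact Finset.sum_congr rfl fun i _ => Finset.sum_congr rfl fun j _ => by ring
      rw [e, ← this]
      exact integral_nonneg fun y => mul_self_nonneg _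
  obtain ⟨d, v, hv⟩ := Matrix.posSemidef_iff_eq_sum_vecMulVec.1 hK
  refine ⟨d, v, fun i j => ?_⟩
  rw [hv, Matrix.sum_apply]
  simp [Matrix.vecMulVec_apply]

theorem exists_generalized_inverse (A : (Fin d → ℝ) →L[ℝ] (Fin k → ℝ)) :
    ∃ B : (Fin k → ℝ) →L[ℝ] (Fin d → ℝ), ∀ w, A (B (A w)) = A w := by
  let A' : (Fin d → ℝ) →ₗ[ℝ] (Fin k → ℝ) := A
  obtain ⟨g, hg⟩ := A'.rangeRestrict.exists_rightInverse_of_surjective A'.range_rangeRestrict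
  obtain ⟨g', hg'⟩ := LinearMap.exists_extend g
  refine ⟨g'.toContinuousLinearMap, fun w => ?_⟩
  have h1 : g' (A w) = g (A'.rangeRestrict w) := by
    rw [← hg']
    rfl
  have h2 := congrArg Subtype.val (LinearMap.congr_fun hg (A'.rangeRestrict w))
  change A' (g' (A w)) = A w
  rw [h1]
  exact h2

/-- Every coordinate of `x - A (B x)`, with `A = combineCLM v`, kills all the `v l`, so its second
moment, computed from `K`, is zero. This holds for every centered law with covariance `K`, Gaussian
or not. -/
theorem IsCentered.ae_mem_range {Q : Measure (Fin k → ℝ)} [IsFiniteMeasure Q]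
    (h : IsCentered Q K) {v : Fin d → Fin k → ℝ} (hv : ∀ i j, K i j = ∑ l, v l i * v l j)
    {B : (Fin k → ℝ) →L[ℝ] (Fin d → ℝ)}
    (hB : ∀ w, combineCLM v (B (combineCLM v w)) = combineCLM v w) :
    ∀ᵐ x ∂Q, combineCLM v (B x) = x := by
  let T : (Fin k → ℝ) →L[ℝ] (Fin k → ℝ) :=
    ContinuousLinearMap.id ℝ _ - (combineCLM v).comp B
  have hT : ∀ l, T (v l) = 0 := by
    intro l
    have := hB (Pi.single l 1)
    rw [combineCLM_single] at this
    simp [T, this]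
  have hzero : ∀ i, ∀ᵐ x ∂Q, T x i = 0 := by
    intro i
    let L : StrongDual ℝ (Fin k → ℝ) := (ContinuousLinearMap.proj i).comp T
    have hL : ∀ l, ∑ a, L (Pi.single a 1) * v l a = 0 := by
      intro l
      rw [← L.apply_eq_sum]
      change T (v l) i = 0
      rw [hT]
      rfl
    have hint : ∫ x, L x * L x ∂Q = 0 := by
      rw [h.integral_dual_mul]
      calc ∑ a, ∑ b, L (Pi.single a 1) * L (Pi.single b 1) * K a b
          = ∑ a, ∑ b, ∑ l, (L (Pi.single a 1) * v l a) * (L (Pi.single b 1) * v l b) := by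
            refine Finset.sum_congr rfl fun a _ => Finset.sum_congr rfl fun b _ => ?_
            rw [hv, Finset.mul_sum]
            exact Finset.sum_congr rfl fun l _ => by ring
        _ = ∑ l, (∑ a, L (Pi.single a 1) * v l a) * ∑ b, L (Pi.single b 1) * v l b := by
            simp_rw [Finset.sum_mul_sum]
            exact (Finset.sum_congr rfl fun a _ => Finset.sum_comm).trans Finset.sum_comm
        _ = 0 := by simp [hL]
    have := (integral_eq_zero_iff_of_nonneg (fun x => mul_self_nonneg (L x))
      ((h.memLp_dual L).integrable_mul (h.memLp_dual L))).1 hint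
    filter_upwards [this] with x hx
    exact mul_self_eq_zero.1 hx
  filter_upwards [ae_all_iff.2 hzero] with x hx
  ext i
  have := hx i
  simp only [T, sub_apply, ContinuousLinearMap.id_apply, Pi.sub_apply,
    ContinuousLinearMap.comp_apply, sub_eq_zero] at this
  exact this.symm

theorem charFunDual_gaussianReal (m : ℝ) (σ : ℝ≥0) (L : StrongDual ℝ ℝ) :
    charFunDual (gaussianReal m σ) L =
      Complex.exp (L 1 * m * Complex.I - σ * (L 1 : ℂ) ^ 2 / 2) := by
  have e := charFun_gaussianReal (μ := m) (v := σ) (L 1)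
  rw [← e, charFun_apply_real, charFunDual_apply]
  refine integral_congr_ae (.of_forall fun x => ?_)
  have : L x = x * L 1 := by rw [← smul_eq_mul, ← map_smul, smul_eq_mul, mul_one]
  simp only [this]
  push_cast
  ring_nf

theorem IsCentered.map_pi_gaussianReal {G : Measure (Fin k → ℝ)} [IsGaussian G]
    (h : IsCentered G K) {v : Fin d → Fin k → ℝ} (hv : ∀ i j, K i j = ∑ l, v l i * v l j) :
    (Measure.pi fun _ : Fin d => gaussianReal 0 1).map (combineCLM v) = G := by
  refine Measure.ext_of_charFunDual (funext fun L => ?_)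
  rw [charFunDual_map, charFunDual_pi, h.charFunDual_gaussian]
  simp_rw [charFunDual_gaussianReal]
  rw [← Complex.exp_sum]
  congr 1
  have e : ∀ l, ((L.comp (combineCLM v)).comp (.single ℝ (fun _ : Fin d => ℝ) l)) 1 =
      ∑ i, L (Pi.single i 1) * v l i := by
    intro l
    rw [← L.apply_eq_sum, ← combineCLM_single v l]
    rfl
  have e' : ∑ i, ∑ j, L (Pi.single i 1) * L (Pi.single j 1) * K i j =
      ∑ l, (∑ i, L (Pi.single i 1) * v l i) ^ 2 := by
    simp_rw [hv, sq, Finset.sum_mul_sum, Finset.mul_sum]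
    refine (Finset.sum_congr rfl fun a _ => Finset.sum_comm).trans ?_
    rw [Finset.sum_comm]
    exact Finset.sum_congr rfl fun l _ => Finset.sum_congr rfl fun i _ =>
      Finset.sum_congr rfl fun j _ => by ring
  simp_rw [e, e']
  push_cast
  rw [neg_div, Finset.sum_div, ← Finset.sum_neg_distrib]
  exact Finset.sum_congr rfl fun l _ => by simp

end Factorization

/-! ### Gaussian smoothing: from weak convergence to measurable test functions. -/

section Smoothing

variable {k d : ℕ}

theorem gaussianPDFReal_le (m : ℝ) (σ : ℝ≥0) (y : ℝ) :
    gaussianPDFReal m σ y ≤ (√(2 * Real.pi * σ))⁻¹ := by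
  rw [gaussianPDFReal]
  refine mul_le_of_le_one_right (by positivity) (Real.exp_le_one_iff.2 ?_)
  rw [neg_div]
  exact neg_nonpos.2 (by positivity)

/-- The density at `y` of the Gaussian law with mean `a • B x` and covariance matrix `b ^ 2 • 1`, as
a bounded continuous function of `x`. -/
noncomputable def gaussianShift (a b : ℝ) (B : (Fin k → ℝ) →L[ℝ] (Fin d → ℝ)) (y : Fin d → ℝ) :
    BoundedContinuousFunction (Fin k → ℝ) ℝ :=
  BoundedContinuousFunction.ofNormedAddCommGroup
    (fun x => ∏ i, gaussianPDFReal (a * B x i) (.mk (b ^ 2) (sq_nonneg b)) (y i))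
    (by unfold gaussianPDFReal; fun_prop)
    (∏ _i : Fin d, (√(2 * Real.pi * (NNReal.mk (b ^ 2) (sq_nonneg b) : ℝ)))⁻¹)
    (fun x => by
      rw [Real.norm_of_nonneg (Finset.prod_nonneg fun i _ => gaussianPDFReal_nonneg _ _ _)]
      exact Finset.prod_le_prod (fun i _ => gaussianPDFReal_nonneg _ _ _)
        fun i _ => gaussianPDFReal_le _ _ _)

theorem gaussianShift_apply (a b : ℝ) (B : (Fin k → ℝ) →L[ℝ] (Fin d → ℝ)) (y : Fin d → ℝ)
    (x : Fin k → ℝ) : gaussianShift a b B y x =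
      ∏ i, gaussianPDFReal (a * B x i) (.mk (b ^ 2) (sq_nonneg b)) (y i) := rfl

theorem gaussianShift_nonneg (a b : ℝ) (B : (Fin k → ℝ) →L[ℝ] (Fin d → ℝ)) (y : Fin d → ℝ)
    (x : Fin k → ℝ) : 0 ≤ gaussianShift a b B y x := by
  rw [gaussianShift_apply]
  exact Finset.prod_nonneg fun _ _ => gaussianPDFReal_nonneg _ _ _

theorem measurable_gaussianShift (a b : ℝ) (B : (Fin k → ℝ) →L[ℝ] (Fin d → ℝ)) :
    Measurable fun p : (Fin k → ℝ) × (Fin d → ℝ) => gaussianShift a b B p.2 p.1 := by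
  simp only [gaussianShift_apply]
  refine Finset.measurable_prod _ fun i _ => ?_
  unfold gaussianPDFReal
  fun_prop

theorem map_pi_gaussianReal_add {b : ℝ} (hb : b ≠ 0) (u : Fin d → ℝ) :
    (Measure.pi fun _ : Fin d => gaussianReal 0 1).map (fun w => u + b • w) =
      volume.withDensity fun y => ∏ i,
        gaussianPDF (u i) (.mk (b ^ 2) (sq_nonneg b)) (y i) := by
  have hb' : NNReal.mk (b ^ 2) (sq_nonneg b) ≠ 0 := fun h =>
    pow_ne_zero 2 hb (congrArg NNReal.toReal h)
  have h1 : ∀ i, (gaussianReal 0 1).map (fun w => u i + b * w) =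
      volume.withDensity (gaussianPDF (u i) (.mk (b ^ 2) (sq_nonneg b))) := by
    intro i
    rw [← gaussianReal_of_var_ne_zero _ hb']
    have : (fun w : ℝ => u i + b * w) = (u i + ·) ∘ (b * ·) := rfl
    rw [this, ← Measure.map_map (by fun_prop) (by fun_prop), gaussianReal_map_const_mul,
      gaussianReal_map_const_add]
    simp
  have : ∀ i, SigmaFinite (volume.withDensity
      (gaussianPDF (u i) (.mk (b ^ 2) (sq_nonneg b)))) := fun i => by
    rw [← gaussianReal_of_var_ne_zero _ hb']; infer_instance
  rw [volume_pi, ← pi_withDensity _ fun i => measurable_gaussianPDF _ _]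
  simp_rw [← h1]
  have : ∀ i, SigmaFinite ((gaussianReal 0 1).map (fun w => u i + b * w)) := fun i => by
    have : IsProbabilityMeasure ((gaussianReal 0 1).map (fun w => u i + b * w)) :=
      Measure.isProbabilityMeasure_map (by fun_prop)
    infer_instance
  exact Measure.pi_map_pi (f := fun i w => u i + b * w) fun i => by fun_prop

/-- The density of the law of `a • B X + b • W`, where `X` has law `Q` and `W` is an independent
standard Gaussian vector. -/
noncomputable def smoothDensity (a b : ℝ) (B : (Fin k → ℝ) →L[ℝ] (Fin d → ℝ))
    (Q : Measure (Fin k → ℝ)) (y : Fin d → ℝ) : ENNReal :=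
  ENNReal.ofReal (∫ x, gaussianShift a b B y x ∂Q)

theorem smoothDensity_eq_lintegral (a b : ℝ) (B : (Fin k → ℝ) →L[ℝ] (Fin d → ℝ))
    (Q : Measure (Fin k → ℝ)) [IsFiniteMeasure Q] (y : Fin d → ℝ) :
    smoothDensity a b B Q y = ∫⁻ x, ENNReal.ofReal (gaussianShift a b B y x) ∂Q :=
  ofReal_integral_eq_lintegral_ofReal ((gaussianShift a b B y).integrable Q)
    (.of_forall (gaussianShift_nonneg a b B y))

theorem measurable_smoothDensity (a b : ℝ) (B : (Fin k → ℝ) →L[ℝ] (Fin d → ℝ))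
    (Q : Measure (Fin k → ℝ)) [IsFiniteMeasure Q] : Measurable (smoothDensity a b B Q) := by
  rw [funext fun y => smoothDensity_eq_lintegral a b B Q y]
  exact Measurable.lintegral_prod_left'
    (f := fun p : (Fin k → ℝ) × (Fin d → ℝ) => ENNReal.ofReal (gaussianShift a b B p.2 p.1))
    (measurable_gaussianShift a b B).ennreal_ofReal

variable {K : Matrix (Fin k) (Fin k) ℝ}

/-- Write `A = combineCLM v`. Almost surely `X = A (B X)`, and `G` is the law of `A W` with `W`
standard Gaussian, so the mixture is the law of `A (a B X + b W)`. Given `X`, the inner vector has a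
density because `b ≠ 0`; then average over `X`. -/
theorem IsCentered.mix_eq_map_withDensity {Q G : Measure (Fin k → ℝ)} [IsProbabilityMeasure Q]
    [IsGaussian G] (hQ : IsCentered Q K) (hG : IsCentered G K) (a : ℝ) {b : ℝ} (hb : b ≠ 0)
    {v : Fin d → Fin k → ℝ} (hv : ∀ i j, K i j = ∑ l, v l i * v l j)
    {B : (Fin k → ℝ) →L[ℝ] (Fin d → ℝ)}
    (hB : ∀ w, combineCLM v (B (combineCLM v w)) = combineCLM v w) :
    _root_.mix a b Q G = (volume.withDensity (smoothDensity a b B Q)).map (combineCLM v) := by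
  refine Measure.ext_of_lintegral _ fun h hh => ?_
  have hA : Measurable fun y => h (combineCLM v y) := by fun_prop
  rw [_root_.mix, lintegral_map hh (by fun_prop), lintegral_prod _ (by fun_prop),
    lintegral_map hh (by fun_prop),
    lintegral_withDensity_eq_lintegral_mul _ (measurable_smoothDensity a b B Q) hA]
  have key : ∀ᵐ x ∂Q, ∫⁻ z, h (a • x + b • z) ∂G =
      ∫⁻ y, ENNReal.ofReal (gaussianShift a b B y x) * h (combineCLM v y) := by
    filter_upwards [hQ.ae_mem_range hv hB] with x hx
    rw [← hG.map_pi_gaussianReal hv, lintegral_map (by fun_prop) (by fun_prop)]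
    have e : ∀ w, h (a • x + b • combineCLM v w) = h (combineCLM v (a • B x + b • w)) := by
      intro w
      rw [map_add, map_smul, map_smul, hx]
    simp_rw [e]
    have hpdf : Measurable fun y : Fin d → ℝ => ∏ i,
        gaussianPDF ((a • B x) i) (.mk (b ^ 2) (sq_nonneg b)) (y i) :=
      Finset.measurable_prod _ fun i _ => (measurable_gaussianPDF _ _).comp (measurable_pi_apply i)
    rw [← lintegral_map (μ := Measure.pi fun _ : Fin d => gaussianReal 0 1) hA (by fun_prop),
      map_pi_gaussianReal_add hb, lintegral_withDensity_eq_lintegral_mul _ hpdf hA]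
    refine lintegral_congr fun y => ?_
    rw [Pi.mul_apply, gaussianShift_apply,
      ENNReal.ofReal_prod_of_nonneg fun i _ => gaussianPDFReal_nonneg _ _ _]
    rfl
  rw [lintegral_congr_ae key, lintegral_lintegral_swap]
  · refine lintegral_congr fun y => ?_
    rw [Pi.mul_apply, smoothDensity_eq_lintegral, lintegral_mul_const _]
    exact (measurable_gaussianShift a b B |>.comp measurable_prodMk_right).ennreal_ofReal
  · exact ((measurable_gaussianShift a b B).ennreal_ofReal.mul
      (hA.comp measurable_snd)).aemeasurable

/-- The density at a fixed point is the integral of a bounded continuous function of `x`, so weak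
convergence of the laws becomes pointwise convergence of densities. -/
theorem tendsto_smoothDensity {Q : ℕ → Measure (Fin k → ℝ)}
    {G : Measure (Fin k → ℝ)} [∀ r, IsProbabilityMeasure (Q r)] [IsProbabilityMeasure G]
    (h : ∀ L, Tendsto (fun r => charFunDual (Q r) L) atTop (𝓝 (charFunDual G L))) (a b : ℝ)
    (B : (Fin k → ℝ) →L[ℝ] (Fin d → ℝ)) (y : Fin d → ℝ) :
    Tendsto (fun r => smoothDensity a b B (Q r) y) atTop (𝓝 (smoothDensity a b B G y)) :=
  ENNReal.tendsto_ofReal (tendsto_integral_of_tendsto_charFunDual h _)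

theorem IsCentered.lintegral_pi_mix {Q G : Measure (Fin k → ℝ)} [IsProbabilityMeasure Q]
    [IsGaussian G] (hQ : IsCentered Q K) (hG : IsCentered G K) (a : ℝ) {b : ℝ} (hb : b ≠ 0)
    {v : Fin d → Fin k → ℝ} (hv : ∀ i j, K i j = ∑ l, v l i * v l j)
    {B : (Fin k → ℝ) →L[ℝ] (Fin d → ℝ)}
    (hB : ∀ w, combineCLM v (B (combineCLM v w)) = combineCLM v w) (n : ℕ)
    {f : (Fin n → Fin k → ℝ) → ENNReal} (hf : Measurable f) :
    ∫⁻ x, f x ∂(Measure.pi fun _ => _root_.mix a b Q G) =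
      ∫⁻ y : Fin n → Fin d → ℝ,
        (∏ t, smoothDensity a b B Q (y t)) * f (fun t => combineCLM v (y t)) := by
  have hmap := hQ.mix_eq_map_withDensity hG a hb hv hB
  have hprob : IsProbabilityMeasure
      ((volume.withDensity (smoothDensity a b B Q)).map (combineCLM v)) :=
    hmap ▸ inferInstance
  have hprob' : IsProbabilityMeasure (volume.withDensity (smoothDensity a b B Q)) :=
    ⟨by rw [← hprob.measure_univ, Measure.map_apply (by fun_prop) .univ, Set.preimage_univ]⟩
  have hdens : Measurable fun y : Fin n → Fin d → ℝ => ∏ t, smoothDensity a b B Q (y t) :=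
    Finset.measurable_prod _ fun t _ =>
      (measurable_smoothDensity a b B Q).comp (measurable_pi_apply t)
  rw [hmap, ← Measure.pi_map_pi (f := fun _ => combineCLM v)
    (μ := fun _ : Fin n => volume.withDensity (smoothDensity a b B Q)) (fun i => by fun_prop),
    lintegral_map hf (by fun_prop), pi_withDensity _ fun _ => measurable_smoothDensity a b B Q,
    lintegral_withDensity_eq_lintegral_mul _ hdens (by fun_prop)]
  rfl

/-- If the laws `Q r` converge to the Gaussian law `G` of the same covariance matrix, then the
expectations of a measurable, possibly discontinuous function `H` under the smoothed laws are
asymptotically at most the one under `G`, provided that `H` is dominated by a function `W` whose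
expectation is the same under all these laws. -/
theorem IsCentered.eventually_lintegral_pi_mix_lt {Q : ℕ → Measure (Fin k → ℝ)}
    {G : Measure (Fin k → ℝ)} [∀ r, IsProbabilityMeasure (Q r)] [IsGaussian G]
    (hQ : ∀ r, IsCentered (Q r) K) (hG : IsCentered G K)
    (h : ∀ L, Tendsto (fun r => charFunDual (Q r) L) atTop (𝓝 (charFunDual G L)))
    {a b : ℝ} (hb : b ≠ 0) (hab : a ^ 2 + b ^ 2 = 1) (n : ℕ)
    {H W : (Fin n → Fin k → ℝ) → ENNReal} (hH : Measurable H) (hW : Measurable W)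
    (hHW : H ≤ W) (hWtop : ∀ x, W x ≠ ⊤) {w : ENNReal} (hw : w ≠ ⊤)
    (hWint : ∀ R : Measure (Fin k → ℝ), IsProbabilityMeasure R → IsCentered R K →
      ∫⁻ x, W x ∂(Measure.pi fun _ => R) = w)
    {c : ENNReal} (hc : ∫⁻ x, H x ∂(Measure.pi fun _ => G) < c) :
    ∀ᶠ r in atTop, ∫⁻ x, H x ∂(Measure.pi fun _ => _root_.mix a b (Q r) G) < c := by
  obtain ⟨d, v, hv⟩ := hG.exists_eq_sum_mul
  obtain ⟨B, hB⟩ := exists_generalized_inverse (combineCLM v)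
  -- Fatou bounds integrals from below in the limit. As `W` has the constant integral `w`, a lower
  -- bound for `W - H` is an upper bound for `H`.
  let J : (Fin n → Fin k → ℝ) → ENNReal := fun x => W x - H x
  have hJ : Measurable J := hW.sub hH
  have hJint : ∀ R : Measure (Fin k → ℝ), IsProbabilityMeasure R → IsCentered R K →
      ∫⁻ x, H x ∂(Measure.pi fun _ => R) ≤ w ∧
      ∫⁻ x, J x ∂(Measure.pi fun _ => R) = w - ∫⁻ x, H x ∂(Measure.pi fun _ => R) := by
    intro R hR hRK
    have hle : ∫⁻ x, H x ∂(Measure.pi fun _ => R) ≤ w :=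
      (lintegral_mono hHW).trans_eq (hWint R hR hRK)
    exact ⟨hle, by rw [lintegral_sub hH (ne_top_of_le_ne_top hw hle) (.of_forall hHW),
      hWint R hR hRK]⟩
  have hmixK : ∀ r, IsCentered (_root_.mix a b (Q r) G) K := fun r => (hQ r).mix hG hab
  have hfatou : ∫⁻ x, J x ∂(Measure.pi fun _ => G) ≤
      liminf (fun r => ∫⁻ x, J x ∂(Measure.pi fun _ => _root_.mix a b (Q r) G)) atTop := by
    -- Writing `G` as its own mixture gives it a density of the same form, which is the limit of the
    -- densities along `Q r`.
    have hGmix : ∫⁻ x, J x ∂(Measure.pi fun _ => G) =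
        ∫⁻ x, J x ∂(Measure.pi fun _ => _root_.mix a b G G) := by
      rw [hG.mix_self hab]
    rw [hGmix, hG.lintegral_pi_mix hG a hb hv hB n hJ]
    simp_rw [fun r => (hQ r).lintegral_pi_mix hG a hb hv hB n hJ]
    refine le_trans (le_of_eq (lintegral_congr fun y => ?_)) (lintegral_liminf_le fun r => ?_)
    · refine (Tendsto.liminf_eq (ENNReal.Tendsto.mul_const ?_ (Or.inr ?_))).symm
      · exact ENNReal.tendsto_finsetProd_of_ne_top _
          (fun t _ => tendsto_smoothDensity h a b B (y t)) fun t _ => ENNReal.ofReal_ne_top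
      · exact ne_top_of_le_ne_top (hWtop _) tsub_le_self
    · exact (Finset.measurable_prod _ fun t _ =>
        (measurable_smoothDensity a b B (Q r)).comp (measurable_pi_apply t)).mul
          (hJ.comp (by fun_prop))
  by_contra hcon
  have hfreq : ∃ᶠ r in atTop, ∫⁻ x, J x ∂(Measure.pi fun _ => _root_.mix a b (Q r) G) ≤ w - c := by
    refine (not_eventually.1 hcon).mono fun r hr => ?_
    rw [(hJint _ inferInstance (hmixK r)).2]
    exact tsub_le_tsub_left (not_lt.1 hr) w
  obtain ⟨r, hr⟩ := (not_eventually.1 hcon).exists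
  have hcw : c ≤ w := (not_lt.1 hr).trans (hJint _ inferInstance (hmixK r)).1
  have hle := hfatou.trans (liminf_le_of_frequently_le' hfreq)
  rw [(hJint G inferInstance hG).2] at hle
  have hHG := (hJint G inferInstance hG).1
  refine absurd hc (not_lt.2 ?_)
  rw [tsub_le_iff_right] at hle
  have h1 : w - c + c ≤ w - c + ∫⁻ x, H x ∂(Measure.pi fun _ => G) := by
    rwa [tsub_add_cancel_of_le hcw]
  exact (ENNReal.add_le_add_iff_left (ne_top_of_le_ne_top hw tsub_le_self)).1 h1

end Smoothing

/-! ### Clipped estimates and their quadratic bound. -/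

theorem IsCentered.lintegral_pi_sum_sq {k : ℕ} {K : Matrix (Fin k) (Fin k) ℝ}
    {R : Measure (Fin k → ℝ)} [IsProbabilityMeasure R] (hR : IsCentered R K) (n : ℕ) (m : Fin k)
    {a b : ℝ} (ha : 0 ≤ a) (hb : 0 ≤ b) :
    ∫⁻ x : Fin n → Fin k → ℝ, ENNReal.ofReal (∑ t, (a * x t m ^ 2 + b))
      ∂(Measure.pi fun _ => R) = ENNReal.ofReal (n * (a * K m m + b)) := by
  have hsq : Integrable (fun y : Fin k → ℝ => a * y m ^ 2 + b) R :=
    ((hR.memLp m).integrable_sq.const_mul a).add (integrable_const b)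
  have hint : ∀ t : Fin n, Integrable (fun x : Fin n → Fin k → ℝ => a * x t m ^ 2 + b)
      (Measure.pi fun _ => R) := fun t =>
    integrable_comp_eval (μ := fun _ : Fin n => R) (i := t) hsq
  rw [← ofReal_integral_eq_lintegral_ofReal (integrable_finsetSum _ fun t _ => hint t)
    (.of_forall fun x => Finset.sum_nonneg fun t _ => by positivity),
    integral_finsetSum _ fun t _ => hint t]
  congr 1
  have h1 : ∀ t : Fin n, ∫ x : Fin n → Fin k → ℝ, (a * x t m ^ 2 + b) ∂(Measure.pi fun _ => R) =
      a * K m m + b := by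
    intro t
    rw [integral_comp_eval (μ := fun _ : Fin n => R) (i := t)
      (f := fun y : Fin k → ℝ => a * y m ^ 2 + b) hsq.aestronglyMeasurable,
      integral_add ((hR.memLp m).integrable_sq.const_mul a) (integrable_const b),
      integral_const_mul, ← hR.second]
    simp [sq]
  simp only [h1, Finset.sum_const, Finset.card_univ, Fintype.card_fin, nsmul_eq_mul]

namespace MemorylessNetwork

variable {k N : ℕ} {net : MemorylessNetwork k N} {n : ℕ}

namespace CodingScheme

theorem clip_dec (C : net.CodingScheme n) (B : ℝ) (m : Fin k) (y : Fin n → ℝ) (t : Fin n) :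
    (C.clip B).dec m y t = max (-B) (min B (C.dec m y t)) := rfl

theorem abs_max_neg_min_le {B : ℝ} (hB : 0 ≤ B) (d : ℝ) : |max (-B) (min B d)| ≤ B := by
  rw [abs_le]
  exact ⟨le_max_left _ _, max_le (by linarith) (min_le_left _ _)⟩

theorem abs_max_neg_min_le_abs {B : ℝ} (hB : 0 ≤ B) (d : ℝ) : |max (-B) (min B d)| ≤ |d| := by
  rw [abs_le]
  constructor
  · rcases le_total B d with h | h
    · rw [min_eq_left h]
      exact (neg_nonpos.2 (abs_nonneg d)).trans (hB.trans (le_max_right _ _))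
    · rw [min_eq_right h]
      exact (neg_abs_le d).trans (le_max_right _ _)
  · exact max_le ((neg_nonpos.2 hB).trans (abs_nonneg d)) ((min_le_right _ _).trans (le_abs_self d))

/-- The right side serves as the dominating function `W`: its expectation depends on the source law
through `K` only. -/
theorem condDistortion_clip_le (C : net.CodingScheme n) {B : ℝ} (hB : 0 ≤ B) (m : Fin k)
    (x : Fin n → Fin k → ℝ) :
    (C.clip B).condDistortion m x ≤ ENNReal.ofReal (∑ t, (2 * x t m ^ 2 + 2 * B ^ 2)) := by
  unfold condDistortion
  refine (lintegral_mono (g := fun _ => ENNReal.ofReal (∑ t, (2 * x t m ^ 2 + 2 * B ^ 2)))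
    fun y => ENNReal.ofReal_le_ofReal ?_).trans (by simp)
  rw [distortion_quadratic]
  refine Finset.sum_le_sum fun t _ => ?_
  rw [clip_dec]
  have := sq_le_sq' (by linarith [(abs_le.1 (abs_max_neg_min_le hB (C.dec m
    (fun τ => y τ (net.dst m)) t))).1]) (abs_le.1 (abs_max_neg_min_le hB (C.dec m
    (fun τ => y τ (net.dst m)) t))).2
  nlinarith [sq_nonneg (x t m + max (-B) (min B (C.dec m (fun τ => y τ (net.dst m)) t)))]

theorem tendsto_lintegral_condDistortion_clip {K : Matrix (Fin k) (Fin k) ℝ}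
    {G : Measure (Fin k → ℝ)} [IsProbabilityMeasure G] (hG : IsCentered G K)
    (C : net.CodingScheme n) (m : Fin k)
    (hfin : ∫⁻ x, C.condDistortion m x ∂(Measure.pi fun _ => G) ≠ ⊤) :
    Tendsto (fun j : ℕ => ∫⁻ x, (C.clip j).condDistortion m x ∂(Measure.pi fun _ => G)) atTop
      (𝓝 (∫⁻ x, C.condDistortion m x ∂(Measure.pi fun _ => G))) := by
  have hlaw : ∀ j : ℕ, ∫⁻ x, (C.clip j).condDistortion m x ∂(Measure.pi fun _ => G) =
      ∫⁻ p, ENNReal.ofReal ((C.clip j).distortion quadraticDistortion m p) ∂C.jointLaw G := by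
    intro j
    rw [jointLaw, Measure.lintegral_compProd (by fun_prop)]
    unfold condDistortion
    simp_rw [outputKernel_clip]
  simp_rw [hlaw]
  rw [lintegral_condDistortion] at hfin ⊢
  -- With `c` the clipped value of `e`: `(x - c) ^ 2 ≤ 2 x ^ 2 + 2 e ^ 2` and `e ^ 2 ≤ 2 x ^ 2 + 2
  -- (x - e) ^ 2`. The `+ 0` matches the shape of `IsCentered.lintegral_pi_sum_sq`.
  let bound : (Fin n → Fin k → ℝ) × (Fin n → Fin N → ℝ) → ENNReal := fun p =>
    ENNReal.ofReal (∑ t, (6 * p.1 t m ^ 2 + 0)) +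
      4 * ENNReal.ofReal (C.distortion quadraticDistortion m p)
  refine tendsto_lintegral_of_dominated_convergence bound (fun j => by fun_prop)
    (fun j => .of_forall fun p => ?_) ?_ (.of_forall fun p => ?_)
  · have h4 : (4 : ENNReal) = ENNReal.ofReal 4 := by simp
    simp only [bound]
    rw [h4, ← ENNReal.ofReal_mul (by norm_num), ← ENNReal.ofReal_add
      (Finset.sum_nonneg fun t _ => by positivity)
      (mul_nonneg (by norm_num) (C.distortion_nonneg m p))]
    refine ENNReal.ofReal_le_ofReal ?_
    rw [distortion_quadratic, distortion_quadratic, Finset.mul_sum, ← Finset.sum_add_distrib]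
    refine Finset.sum_le_sum fun t _ => ?_
    rw [clip_dec]
    have := sq_le_sq.2 (abs_max_neg_min_le_abs (Nat.cast_nonneg j) (C.dec m
      (fun τ => p.2 τ (net.dst m)) t))
    set c := max (-(j : ℝ)) (min j (C.dec m (fun τ => p.2 τ (net.dst m)) t))
    set e := C.dec m (fun τ => p.2 τ (net.dst m)) t
    nlinarith [sq_nonneg (p.1 t m + c), sq_nonneg (2 * p.1 t m - e)]
  · rw [lintegral_add_left (by fun_prop), lintegral_const_mul _ (by fun_prop)]
    refine ENNReal.add_ne_top.2 ⟨?_, ENNReal.mul_ne_top (by simp) hfin⟩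
    rw [jointLaw, Measure.lintegral_compProd (by fun_prop)]
    simp only [lintegral_const, measure_univ, mul_one]
    rw [hG.lintegral_pi_sum_sq n m (by norm_num) le_rfl]
    exact ENNReal.ofReal_ne_top
  · refine ENNReal.tendsto_ofReal ?_
    simp_rw [distortion_quadratic]
    refine tendsto_finsetSum _ fun t _ => tendsto_const_nhds.congr' ?_
    filter_upwards [eventually_ge_atTop ⌈|C.dec m (fun τ => p.2 τ (net.dst m)) t|⌉₊] with j hj
    have hj' := abs_le.1 (Nat.ceil_le.1 hj)
    rw [clip_dec, min_eq_right hj'.2, max_eq_right hj'.1]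

end CodingScheme

/-! ### Dithering, and transfer from the Gaussian source. -/

theorem Feasible.of_map_add {P : Measure (Fin k → ℝ)} [IsProbabilityMeasure P] (u : Fin k → ℝ)
    {D : Fin k → ℝ} (h : net.Feasible n (P.map fun x => x + u) D) : net.Feasible n P D := by
  obtain ⟨h0, C, hC⟩ := h
  refine ⟨h0, C.affine 1 fun _ => u, fun m => (le_of_eq ?_).trans (hC m)⟩
  have hprob : IsProbabilityMeasure (P.map fun x => x + u) :=
    Measure.isProbabilityMeasure_map (by fun_prop)
  have hmap : MeasurePreserving (fun x : Fin n → Fin k → ℝ => fun t => x t + u)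
      (Measure.pi fun _ => P) (Measure.pi fun _ => P.map fun x => x + u) :=
    measurePreserving_pi (fun _ : Fin n => P) (fun _ => P.map fun x => x + u)
      (f := fun _ x => x + u) fun _ => ⟨by fun_prop, rfl⟩
  rw [← hmap.lintegral_comp (C.measurable_condDistortion m)]
  refine lintegral_congr fun x => ?_
  rw [C.condDistortion_affine one_ne_zero]
  simp
  rfl

theorem dyadicRegion_of_map_add {P : Measure (Fin k → ℝ)} [IsProbabilityMeasure P] (u : Fin k → ℝ)
    {D : Fin k → ℝ} (h : D ∈ net.dyadicRegion n (P.map fun x => x + u)) :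
    D ∈ net.dyadicRegion n P := by
  obtain ⟨r, h⟩ := h
  exact ⟨r, h.of_map_add u⟩

/-- The dither block `ω` enters as a parameter of the scheme, known to encoders and decoders. By
Tonelli, averaging over `ω` makes `C` see the mixture; undoing the scaling costs `1 / a ^ 2`. -/
theorem add_mem_dyadicRegion_of_mix {Q G : Measure (Fin k → ℝ)} [IsProbabilityMeasure Q]
    [IsProbabilityMeasure G] (hn : 0 < n) (C : net.CodingScheme n) {a b : ℝ} (ha : a ≠ 0)
    {D D' : Fin k → ℝ} (hD' : ∀ m, 0 ≤ D' m) (hDD' : ∀ m, D m ≤ a ^ 2 * D' m)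
    (h : ∀ m, ∫⁻ x, C.condDistortion m x ∂(Measure.pi fun _ => mix a b Q G) ≤
      ENNReal.ofReal (n * D m)) {ε : ℝ} (hε : 0 < ε) :
    (fun m => D' m + ε) ∈ net.dyadicRegion n Q := by
  have hF : ∀ m, Measurable fun p : (Fin n → Fin k → ℝ) × (Fin n → Fin k → ℝ) =>
      C.condDistortion m (a • p.1 + b • p.2) := fun m =>
    (C.measurable_condDistortion m).comp (by fun_prop)
  have e : ∀ m (ω : Fin n → Fin k → ℝ),
      ∫⁻ x, (C.affine a (b • ω)).condDistortion m x ∂(Measure.pi fun _ => Q) =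
        ENNReal.ofReal ((a ^ 2)⁻¹) *
          ∫⁻ x, C.condDistortion m (a • x + b • ω) ∂(Measure.pi fun _ => Q) := by
    intro m ω
    simp_rw [C.condDistortion_affine ha]
    exact lintegral_const_mul _ ((hF m).comp measurable_prodMk_right)
  have hmeas : ∀ m, Measurable fun ω : Fin n → Fin k → ℝ =>
      ∫⁻ x, C.condDistortion m (a • x + b • ω) ∂(Measure.pi fun _ => Q) :=
    fun m => (hF m).lintegral_prod_left'
  refine add_mem_dyadicRegion_of_random (Measure.pi fun _ : Fin n => G)
    (fun ω => C.affine a (b • ω)) hn (fun m => ?_) (fun m => ?_) hD' hε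
  · simp_rw [e]
    exact (hmeas m).const_mul _
  · simp_rw [e]
    rw [lintegral_const_mul _ (hmeas m), ← lintegral_prod_symm _ (hF m).aemeasurable,
      (measurePreserving_pi_mix n a b Q G).lintegral_comp (C.measurable_condDistortion m)]
    refine (mul_le_mul_right (h m) _).trans ?_
    rw [← ENNReal.ofReal_mul (by positivity)]
    refine ENNReal.ofReal_le_ofReal ?_
    have ha2 : 0 < a ^ 2 := by positivity
    rw [inv_mul_le_iff₀ ha2]
    calc (n : ℝ) * D m ≤ n * (a ^ 2 * D' m) := by gcongr; exact hDD' m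
      _ = a ^ 2 * (n * D' m) := by ring

theorem add_mem_dyadicRegion_of_feasible_gaussian {K : Matrix (Fin k) (Fin k) ℝ}
    {P G : Measure (Fin k → ℝ)} [IsProbabilityMeasure P] [IsGaussian G] (hP : IsCentered P K)
    (hG : IsCentered G K) (hn : 0 < n) {D : Fin k → ℝ} (hD : net.Feasible n G D) {ε : ℝ}
    (hε : 0 < ε) : (fun m => D m + ε) ∈ net.dyadicRegion n P := by
  have hn' : (0 : ℝ) < n := by exact_mod_cast hn
  obtain ⟨hD0, C, hC⟩ := hD
  -- Budget for `ε`: a quarter for clipping and the limit in `r`, a quarter for the factor `1 / a ^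
  -- 2`, a half for derandomization.
  have hlt : ∀ m, ENNReal.ofReal (n * D m) < ENNReal.ofReal (n * (D m + ε / 4)) := fun m =>
    (ENNReal.ofReal_lt_ofReal_iff (mul_pos hn' (by linarith [hD0 m]))).2
      (by gcongr; linarith)
  obtain ⟨j, hj⟩ : ∃ j : ℕ, ∀ m, ∫⁻ x, (C.clip j).condDistortion m x ∂(Measure.pi fun _ => G) <
      ENNReal.ofReal (n * (D m + ε / 4)) := by
    refine (eventually_all.2 fun m => ?_).exists (f := atTop)
    exact (C.tendsto_lintegral_condDistortion_clip hG m
      ((hC m).trans_lt ENNReal.ofReal_lt_top).ne).eventually_lt_const ((hC m).trans_lt (hlt m))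
  -- `M` dominates every `D m + ε / 2`, so `b ^ 2 * M = ε / 4` bounds the scaling loss for all `m`;
  -- the summand `ε` keeps `M` positive and `b ^ 2 < 1`.
  set M : ℝ := ∑ m, D m + ε with hM
  have hDM : ∀ m, D m + ε / 2 ≤ M := fun m => by
    linarith [Finset.single_le_sum (fun i _ => hD0 i) (Finset.mem_univ m)]
  have hMε : ε ≤ M := by linarith [Finset.sum_nonneg fun i (_ : i ∈ Finset.univ) => hD0 i]
  have hM0 : 0 < M := hε.trans_le hMε
  set b : ℝ := √(ε / (4 * M)) with hb
  have hb0 : 0 < b := Real.sqrt_pos.2 (by positivity)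
  have hb2 : b ^ 2 = ε / (4 * M) := Real.sq_sqrt (by positivity)
  have hb2M : b ^ 2 * M = ε / 4 := by rw [hb2]; field_simp
  have hb1 : b ^ 2 < 1 := by nlinarith
  set a : ℝ := √(1 - b ^ 2) with ha
  have ha0 : 0 < a := Real.sqrt_pos.2 (by linarith)
  have ha2 : a ^ 2 = 1 - b ^ 2 := Real.sq_sqrt (by linarith)
  have hDD' : ∀ m, D m + ε / 4 ≤ a ^ 2 * (D m + ε / 2) := fun m => by
    have := mul_le_mul_of_nonneg_left (hDM m) (sq_nonneg b)
    rw [ha2, sub_mul, one_mul]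
    linarith
  obtain ⟨r, hr⟩ : ∃ r, ∀ Q, IsButterflyLeaf r P Q → ∀ m,
      ∫⁻ x, (C.clip j).condDistortion m x ∂(Measure.pi fun _ => mix a b Q G) <
        ENNReal.ofReal (n * (D m + ε / 4)) := by
    -- One `r` must serve all leaves of level `r`. Otherwise each level has a bad leaf, and the
    -- central limit theorem, valid along any choice of leaves, applies to this sequence.
    by_contra! hcon
    choose Q hQ m hm using hcon
    have hprob : ∀ r, IsProbabilityMeasure (Q r) := fun r => (hQ r).isProbabilityMeasure
    have hev : ∀ m, ∀ᶠ r in atTop,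
        ∫⁻ x, (C.clip j).condDistortion m x ∂(Measure.pi fun _ => mix a b (Q r) G) <
          ENNReal.ofReal (n * (D m + ε / 4)) := fun m =>
      IsCentered.eventually_lintegral_pi_mix_lt (fun r => (hQ r).isCentered hP) hG
        (tendsto_charFunDual_butterflyLeaf hP hG hQ) hb0.ne' (by rw [ha2]; ring) n
        ((C.clip j).measurable_condDistortion m)
        (W := fun x => ENNReal.ofReal (∑ t, (2 * x t m ^ 2 + 2 * (j : ℝ) ^ 2))) (by fun_prop)
        (fun x => C.condDistortion_clip_le (Nat.cast_nonneg j) m x)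
        (fun x => ENNReal.ofReal_ne_top) ENNReal.ofReal_ne_top
        (fun R _ hR => hR.lintegral_pi_sum_sq n m (by norm_num) (by positivity)) (hj m)
    obtain ⟨r, hr⟩ := (eventually_all.2 hev).exists
    exact (hr (m r)).not_ge (hm r)
  refine mem_dyadicRegion_of_forall_leaf r P fun Q hQ => ?_
  have := hQ.isProbabilityMeasure
  have := add_mem_dyadicRegion_of_mix hn (C.clip j) ha0.ne' (b := b)
    (D' := fun m => D m + ε / 2) (fun m => by linarith [hD0 m]) hDD' (fun m => (hr Q hQ m).le)
    (half_pos hε)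
  simpa only [add_assoc, add_halves] using this

end MemorylessNetwork

/-! ### Removing the means, and the theorem. -/

theorem HasCovarianceMatrix.isCentered {k : ℕ} {P : Measure (Fin k → ℝ)} [IsProbabilityMeasure P]
    {K : Matrix (Fin k) (Fin k) ℝ} (h : HasCovarianceMatrix P K) :
    IsCentered (P.map fun x => x - fun i => ∫ y, y i ∂P) K where
  memLp i := by
    rw [memLp_map_measure_iff (Measurable.aestronglyMeasurable (by fun_prop)) (by fun_prop)]
    exact (h.memLp i).sub (memLp_const _)
  mean i := by
    rw [integral_map (by fun_prop) (Measurable.aestronglyMeasurable (by fun_prop))]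
    simp only [Pi.sub_apply]
    rw [integral_sub ((h.memLp i).integrable one_le_two) (integrable_const _)]
    simp
  second i j := by
    rw [integral_map (by fun_prop) (Measurable.aestronglyMeasurable (by fun_prop)),
      ← h.covariance_eq]
    rfl

theorem MemorylessNetwork.Achievable.add_of_gaussian {k N : ℕ} {net : MemorylessNetwork k N}
    {K : Matrix (Fin k) (Fin k) ℝ} {PG : Measure (Fin k → ℝ)} [IsGaussian PG]
    (hPG : HasCovarianceMatrix PG K) {P : Measure (Fin k → ℝ)} [IsProbabilityMeasure P]
    (hP : HasCovarianceMatrix P K) {D : Fin k → ℝ}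
    (hD : net.Achievable quadraticDistortion PG D) {ε : ℝ} (hε : 0 < ε) :
    net.Achievable quadraticDistortion P fun m => D m + ε := by
  obtain ⟨n, hn, hD⟩ := (achievable_iff_exists_feasible net PG D).1 hD
  have hcenter : ∀ (R : Measure (Fin k → ℝ)) (u : Fin k → ℝ),
      (R.map fun x => x - u).map (fun x => x + u) = R := by
    intro R u
    rw [Measure.map_map (by fun_prop) (by fun_prop)]
    have : (fun x => x + u) ∘ (fun x : Fin k → ℝ => x - u) = id := by ext; simp
    rw [this, Measure.map_id]
  have hprob : ∀ (R : Measure (Fin k → ℝ)) (_ : IsProbabilityMeasure R) (u : Fin k → ℝ),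
      IsProbabilityMeasure (R.map fun x => x - u) :=
    fun R _ u => Measure.isProbabilityMeasure_map (by fun_prop)
  have := hprob P inferInstance fun i => ∫ y, y i ∂P
  -- Translation works in both directions: the scheme for `PG` is moved to its centered version
  -- here, and the result for centered `P` is moved back below.
  have hG : net.Feasible n (PG.map fun x => x - fun i => ∫ y, y i ∂PG) D :=
    Feasible.of_map_add (fun i => ∫ y, y i ∂PG) (by rwa [hcenter])
  have hmem := add_mem_dyadicRegion_of_feasible_gaussian hP.isCentered hPG.isCentered hn hG hε
  obtain ⟨r, hr⟩ := dyadicRegion_of_map_add (P := P) (-fun i => ∫ y, y i ∂P)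
    (by simpa only [sub_eq_add_neg] using hmem)
  exact (achievable_iff_exists_feasible net P _).2 ⟨n * 2 ^ r, by positivity, hr⟩

theorem theorem1 {k N : ℕ} (net : MemorylessNetwork k N) (K : Matrix (Fin k) (Fin k) ℝ)
    (PG : Measure (Fin k → ℝ)) [IsGaussian PG]
    (hPG : HasCovarianceMatrix PG K)
    (P : Measure (Fin k → ℝ)) [IsProbabilityMeasure P] (hP : HasCovarianceMatrix P K) :
    net.distortionRegion quadraticDistortion PG ⊆ net.distortionRegion quadraticDistortion P ∧
      ∀ D : Fin k → ℝ, net.Achievable quadraticDistortion PG D →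
        ∀ ε : ℝ, 0 < ε → net.Achievable quadraticDistortion P (fun m => D m + ε) := by
  have key : ∀ D : Fin k → ℝ, net.Achievable quadraticDistortion PG D →
      ∀ ε : ℝ, 0 < ε → net.Achievable quadraticDistortion P (fun m => D m + ε) :=
    fun D hD ε hε => hD.add_of_gaussian hPG hP hε
  refine ⟨closure_minimal (fun D hD => ?_) isClosed_closure, key⟩
  refine Metric.mem_closure_iff.2 fun ε hε => ⟨_, key D hD (ε / 2) (half_pos hε), ?_⟩
  refine (dist_pi_le_iff (half_pos hε).le).2 (fun m => ?_) |>.trans_lt (half_lt_self hε)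
  rw [Real.dist_eq, sub_add_cancel_left, abs_neg, abs_of_pos (half_pos hε)]
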